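/- **Notation.** Let $m,n,p,q$ be non-negative integers, $a_{-m},\dots,a_n,\ b_0,\dots,b_{n+m}\in\mathbb C^{p\times q}$, and let $$T=(a_{i-j}),\qquad H=(b_{i+j}),\qquad 0\le i\le n,\ 0\le j\le m,$$ be the corresponding block Toeplitz and block Hankel matrices, of size $(n+1)p\times(m+1)q$. Put $$A_j=\begin{pmatrix} b_{n-j}&a_{n-m-j}\\ a_j&b_{j+m}\end{pmatrix}\in\mathbb C^{2p\times 2q}\quad(-m\le j\le n),\qquad A(z)=\sum_{j=-m}^nA_jz^j,\qquad N=2(p+q).$$ *Indices.* For $-m-1\le k\le n+1$ let $\mathcal N_k^R$ be the space of column polynomials $R(z)=\sum_{j=0}^{k+m}r_jz^j$, $r_j\in\mathbb C^{2q}$, with $\sum_{j=0}^{k+m}A_{i-j}r_j=0$ for $i=k,\dots,n$, and let $\mathcal N_k^L$ be the space of row polynomials $L(z)=\sum_{j=0}^{n-k}l_{-j}z^{-j}$ in $z^{-1}$, $l_{-j}\in\mathbb C^{1\times 2p}$, with $\sum_{j=0}^{n-k}l_{-j}A_{i+j}=0$ for $i=-m,\dots,k$ (so $\mathcal N^R_{-m-1}=0$,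 $\mathcal N^L_{n+1}=0$). Let $\Delta_k=\dim\mathcal N_k^R-\dim\mathcal N_{k-1}^R$ for $-m\le k\le n+1$. The indices $\mu_1\le\dots\le\mu_N$ are the integers in $[-m-1,n+1]$ such that $\Delta_k$ is the number of $i$ with $\mu_i<k$, for $-m\le k\le n+1$; explicitly, $\mu_i=-m-1+\#\{k\in[-m,n+1]:\Delta_k<i\}$. Let $d(z)=\operatorname{diag}(z^{\mu_1},\dots,z^{\mu_N})$. *Full right systems.* A full right system consists of a $2q\times N$ matrix polynomial $\mathcal R(z)=(R_1(z)\dots R_N(z))$ and a $2p\times N$ matrix polynomial $\alpha_-(z)$ in $z^{-1}$ such that 1. for each $k\in[-m-1,n]$ the $R_j$ with $\mu_j=k$ form a basis of a complement of $\mathcal N_k^R+z\mathcal N_k^R$ in $\mathcal N_{k+1}^R$ (they are right essential polynomials); 2. $A(z)\mathcal R(z)=\alpha_-(z)d(z)-z^{n+1}\beta_+(z)$ for some matrix polynomial $\beta_+(z)$ in $z$; 3. (complementation) the $R_j$ with $\mu_j=n+1$ have degree at most $n+m+2$, and the constant terms $\alpha_{-,j}(\infty)$ of the corresponding columns of $\alpha_-$,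 together with the columns of $A_{-m},\dots,A_n$, span $\mathbb C^{2p}$. There are $\omega=\dim\mathcal N_n^L$ indices equal to $n+1$; if $\omega=0$, condition 3 holds automatically and $\mathcal R$ determines $\alpha_-$. A matrix polynomial $\mathcal L(z)$ in $z^{-1}$ of size $N\times 2p$ is *conforming* to $(\mathcal R,\alpha_-)$ if $$U_-(z)=\begin{pmatrix}z^{-m-1}\mathcal R(z)d(z)^{-1}\\ \alpha_-(z)\end{pmatrix}$$ is unimodular (it is a matrix polynomial in $z^{-1}$ with an inverse of the same kind) and $U_-^{-1}=(\,*\ \ \mathcal L\,)$. *Full left systems.* Symmetrically, a full left system consists of an $N\times 2p$ matrix polynomial $\mathcal L(z)$ in $z^{-1}$ with rows $L_1,\dots,L_N$ and an $N\times 2q$ matrix polynomial $\alpha_+(z)$ in $z$ such that for each $k\in[-m,n+1]$ the $L_j$ with $\mu_j=k$ form a basis of a complement of $\mathcal N_k^L+z^{-1}\mathcal N_k^L$ in $\mathcal N_{k-1}^L$; $\mathcal L(z)A(z)=d(z)\alpha_+(z)-z^{-m-1}\beta_-(z)$ for some matrix polynomial $\beta_-$ in $z^{-1}$; and the $L_j$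 with $\mu_j=-m-1$ have degree at most $n+m+2$ in $z^{-1}$, while the constant terms $\alpha_{+,j}(0)$ of the corresponding rows of $\alpha_+$, together with the rows of $A_{-m},\dots,A_n$, span $\mathbb C^{1\times 2q}$. A $2q\times N$ matrix polynomial $\mathcal R(z)$ is *conforming* to $(\mathcal L,\alpha_+)$ if $U_+(z)=(\alpha_+(z)\ \ z^{n+1}d(z)^{-1}\mathcal L(z))$ is unimodular (a matrix polynomial in $z$ with an inverse of the same kind) and $\mathcal R$ is the upper block, of $2q$ rows, of $U_+^{-1}$. A pair $(\mathcal R,\mathcal L)$ is *conforming* if $\mathcal L$ is conforming to some full right system $(\mathcal R,\alpha_-)$, or $\mathcal R$ is conforming to some full left system $(\mathcal L,\alpha_+)$. *Factors.* Write $\mathcal R=\binom{\mathcal R^1}{\mathcal R^2}$ and $\mathcal L=(\mathcal L^1\ \mathcal L^2)$, with blocks of $q$ rows and of $p$ columns respectively. With $\mathcal R^l_k$, $\mathcal L^l_k$ the coefficients of $z^k$, let $T_{\mathcal R_l}$ be the lower triangular block Toeplitz matrix $(\mathcal R^l_{i-j})_{0\le j\le i\le m}$ and $T_{\mathcal L_l}$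 the upper triangular block Toeplitz matrix $(\mathcal L^l_{i-j})_{0\le i\le j\le n}$. Let $J$ denote the block flips (identity blocks on the block antidiagonal), $H_{\mathcal R_2}=JT_{\mathcal R_2}$, $H_{\mathcal L_1}=T_{\mathcal L_1}J$. Let $\Pi=(\Pi_{i-j})_{0\le i\le m,\,0\le j\le n}$, where $\Pi_k$ is the diagonal $N\times N$ matrix whose $i$-th diagonal entry is $1$ if $\mu_i=-k$ and $0$ otherwise. **Theorem.** Full right systems and full left systems exist; every full right system has a conforming $\mathcal L$, and every full left system has a conforming $\mathcal R$. For every conforming pair $(\mathcal R,\mathcal L)$ and each choice of sign, the matrix $$X_\pm=\tfrac12\,(T_{\mathcal R_1}\pm H_{\mathcal R_2})\,\Pi\,(T_{\mathcal L_2}\pm H_{\mathcal L_1})$$ is a generalized inverse of $T\pm H$: $(T\pm H)X_\pm(T\pm H)=T\pm H$. If $T\pm H$ is invertible, $X_\pm$ is its inverse; if $T\pm H$ is left (right) invertible, $X_\pm$ is a left (right) inverse of it. No invertibility of $T\mp H$ is needed. -/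

import Mathlib

open scoped LaurentPolynomial

namespace ToeplitzHankel

noncomputable section

/-! ### Laurent polynomials and Laurent matrix polynomials in the variable `z = T 1` -/

/-- Only the powers `z ^ k` with `lo ≤ k ≤ hi` occur in `f`. -/
def SupportedIn (f : ℂ[T;T⁻¹]) (lo hi : ℤ) : Prop :=
  ∀ k, f.coeff k ≠ 0 → lo ≤ k ∧ k ≤ hi

/-- `M` is a matrix polynomial in `z`. -/
def IsPolyInZ {ι κ : Type} (M : Matrix ι κ ℂ[T;T⁻¹]) : Prop :=
  ∀ i j k, (M i j).coeff k ≠ 0 → 0 ≤ k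

/-- `M` is a matrix polynomial in `z⁻¹`. -/
def IsPolyInZInv {ι κ : Type} (M : Matrix ι κ ℂ[T;T⁻¹]) : Prop :=
  ∀ i j k, (M i j).coeff k ≠ 0 → k ≤ 0

/-- Multiplication of a Laurent vector polynomial by `z ^ s`. -/
def shift (κ : Type) (s : ℤ) : (κ → ℂ[T;T⁻¹]) →ₗ[ℂ] (κ → ℂ[T;T⁻¹]) :=
  (LinearMap.mulLeft ℂ (LaurentPolynomial.T s : ℂ[T;T⁻¹])).compLeft κ

/-- The family `v` is a basis of a complement of `S` in `W`. -/
structure IsComplementBasis {V τ : Type} [AddCommGroup V] [Module ℂ V]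
    (v : τ → V) (S W : Submodule ℂ V) : Prop where
  linearIndependent : LinearIndependent ℂ v
  disjoint : Disjoint S (Submodule.span ℂ (Set.range v))
  sup_eq : S ⊔ Submodule.span ℂ (Set.range v) = W

section Sequence

/-! ### Indices and essential polynomials of a sequence `A_{-m}, …, A_n`

A sequence is given as a function on `ℤ`; only its values on `[-m, n]` are used. -/

variable {ι κ : Type} [Fintype ι] [Fintype κ] [DecidableEq ι] [DecidableEq κ] {N : ℕ}

/-- The generating function `A(z) = ∑_{k=-m}^n A_k z^k`. -/
def genFun (A : ℤ → Matrix ι κ ℂ) (m n : ℕ) : Matrix ι κ ℂ[T;T⁻¹] :=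
  Matrix.of fun i j => ∑ k ∈ Finset.Icc (-(m : ℤ)) n,
    LaurentPolynomial.C (A k i j) * LaurentPolynomial.T k

/-- `σ_R {R(z)} = ∑_{j=-n}^m A_{-j} r_j` for the column `R(z) = ∑_{j=-n}^m r_j z^j`. -/
def sigmaR (A : ℤ → Matrix ι κ ℂ) (m n : ℕ) (r : κ → ℂ[T;T⁻¹]) : ι → ℂ :=
  ∑ j ∈ Finset.Icc (-(n : ℤ)) m, Matrix.mulVec (A (-j)) fun t => (r t).coeff j

/-- `σ_L {L(z)} = ∑_{j=-n}^m l_j A_{-j}` for the row `L(z) = ∑_{j=-n}^m l_j z^j`. -/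
def sigmaL (A : ℤ → Matrix ι κ ℂ) (m n : ℕ) (l : ι → ℂ[T;T⁻¹]) : κ → ℂ :=
  ∑ j ∈ Finset.Icc (-(n : ℤ)) m, Matrix.vecMul (fun t => (l t).coeff j) (A (-j))

/-- The space `N_k^R`, isomorphic to the right kernel of `T_k` for `-m ≤ k ≤ n`: column polynomials
`R(z)` of formal degree `k + m` with `σ_R {z^{-i} R(z)} = 0` for `i = k, …, n`.  For `k = -m - 1`
this is zero, and for `k = n + 1` all column polynomials of formal degree `n + m + 1`. -/
def rightSpace (A : ℤ → Matrix ι κ ℂ) (m n : ℕ) (k : ℤ) : Submodule ℂ (κ → ℂ[T;T⁻¹]) where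
  carrier := {r | (∀ t, SupportedIn (r t) 0 (k + m)) ∧
    ∀ i ∈ Finset.Icc k (n : ℤ), sigmaR A m n (shift κ (-i) r) = 0}
  zero_mem' := by
    refine ⟨fun t k hk => by simp at hk, fun i _ => ?_⟩
    rw [map_zero]
    exact Finset.sum_eq_zero fun j _ => Matrix.mulVec_zero _
  add_mem' := by
    rintro x y ⟨hx, hx'⟩ ⟨hy, hy'⟩
    refine ⟨fun t k hk => ?_, fun i hi => ?_⟩
    · by_cases h : (x t).coeff k = 0
      · exact hy t k fun h' => hk (by simp [h, h'])
      · exact hx t k h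
    · have : sigmaR A m n (shift κ (-i) (x + y))
          = sigmaR A m n (shift κ (-i) x) + sigmaR A m n (shift κ (-i) y) := by
        rw [map_add]
        simp only [sigmaR]
        rw [← Finset.sum_add_distrib]
        exact Finset.sum_congr rfl fun j _ => Matrix.mulVec_add _ _ _
      rw [this, hx' i hi, hy' i hi, add_zero]
  smul_mem' := by
    rintro c x ⟨hx, hx'⟩
    refine ⟨fun t k hk => hx t k fun h => hk (by simp [h]), fun i hi => ?_⟩
    have : sigmaR A m n (shift κ (-i) (c • x)) = c • sigmaR A m n (shift κ (-i) x) := by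
      rw [map_smul]
      simp only [sigmaR]
      rw [Finset.smul_sum]
      exact Finset.sum_congr rfl fun j _ => Matrix.mulVec_smul _ _ _
    rw [this, hx' i hi, smul_zero]

/-- The space `N_k^L`, isomorphic to the left kernel of `T_k` for `-m ≤ k ≤ n`: row polynomials
`L(z)` in `z⁻¹` of formal degree `n - k` with `σ_L {z^{-i} L(z)} = 0` for `i = -m, …, k`. -/
def leftSpace (A : ℤ → Matrix ι κ ℂ) (m n : ℕ) (k : ℤ) : Submodule ℂ (ι → ℂ[T;T⁻¹]) where
  carrier := {l | (∀ t, SupportedIn (l t) (k - n) 0) ∧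
    ∀ i ∈ Finset.Icc (-(m : ℤ)) k, sigmaL A m n (shift ι (-i) l) = 0}
  zero_mem' := by
    refine ⟨fun t k hk => by simp at hk, fun i _ => ?_⟩
    rw [map_zero]
    exact Finset.sum_eq_zero fun j _ => Matrix.zero_vecMul _
  add_mem' := by
    rintro x y ⟨hx, hx'⟩ ⟨hy, hy'⟩
    refine ⟨fun t k hk => ?_, fun i hi => ?_⟩
    · by_cases h : (x t).coeff k = 0
      · exact hy t k fun h' => hk (by simp [h, h'])
      · exact hx t k h
    · have : sigmaL A m n (shift ι (-i) (x + y))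
          = sigmaL A m n (shift ι (-i) x) + sigmaL A m n (shift ι (-i) y) := by
        rw [map_add]
        simp only [sigmaL]
        rw [← Finset.sum_add_distrib]
        exact Finset.sum_congr rfl fun j _ => Matrix.add_vecMul _ _ _
      rw [this, hx' i hi, hy' i hi, add_zero]
  smul_mem' := by
    rintro c x ⟨hx, hx'⟩
    refine ⟨fun t k hk => hx t k fun h => hk (by simp [h]), fun i hi => ?_⟩
    have : sigmaL A m n (shift ι (-i) (c • x)) = c • sigmaL A m n (shift ι (-i) x) := by
      rw [map_smul]
      simp only [sigmaL]
      rw [Finset.smul_sum]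
      exact Finset.sum_congr rfl fun j _ => Matrix.smul_vecMul _ _ _
    rw [this, hx' i hi, smul_zero]

/-- `Δ_k^R = dim N_k^R - dim N_{k-1}^R`. -/
def rightIncrement (A : ℤ → Matrix ι κ ℂ) (m n : ℕ) (k : ℤ) : ℤ :=
  (Module.finrank ℂ (rightSpace A m n k) : ℤ) - Module.finrank ℂ (rightSpace A m n (k - 1))

/-- The `i`-th index of the sequence (`i = 0, 1, …`).  As `Δ_{-m}^R ≤ … ≤ Δ_{n+1}^R`, these are
the nondecreasing integers in `[-m - 1, n + 1]` such that `Δ_k^R` is the number of indices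
smaller than `k`, for `-m ≤ k ≤ n + 1`; so `k ∈ [-m, n]` has multiplicity `Δ_{k+1}^R - Δ_k^R`,
`-m - 1` has multiplicity `α = dim N_{-m}^R`, and `n + 1` has multiplicity `ω = dim N_n^L`. -/
def essentialIndex (A : ℤ → Matrix ι κ ℂ) (m n : ℕ) (i : ℕ) : ℤ :=
  -(m : ℤ) - 1 +
    ((Finset.Icc (-(m : ℤ)) (n + 1)).filter fun k => rightIncrement A m n k ≤ i).card

/-- The indices as a tuple of `N` integers; `N` will be the number of rows plus the number of
columns of the blocks. -/
def indices (A : ℤ → Matrix ι κ ℂ) (m n : ℕ) (N : ℕ) : Fin N → ℤ :=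
  fun i => essentialIndex A m n i

/-- `d(z) = diag(z^{μ_1}, …, z^{μ_N})`. -/
def indexDiag (μ : Fin N → ℤ) : Matrix (Fin N) (Fin N) ℂ[T;T⁻¹] :=
  Matrix.diagonal fun j => LaurentPolynomial.T (μ j)

/-- `d(z)⁻¹`. -/
def indexDiagInv (μ : Fin N → ℤ) : Matrix (Fin N) (Fin N) ℂ[T;T⁻¹] :=
  Matrix.diagonal fun j => LaurentPolynomial.T (-μ j)

/-- The columns of `R` with index at most `n` are right essential polynomials: for every
`k ∈ [-m - 1, n]` those with index `k` form a basis of a complement of `N_k^R + z N_k^R` in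
`N_{k+1}^R`.  (For `k = -m - 1` this says that they form a basis of `N_{-m}^R`.) -/
def IsRightEssential (A : ℤ → Matrix ι κ ℂ) (m n : ℕ) (R : Matrix κ (Fin N) ℂ[T;T⁻¹]) : Prop :=
  ∀ k ∈ Finset.Icc (-(m : ℤ) - 1) n,
    IsComplementBasis (fun (j : {j : Fin N // indices A m n N j = k}) (t : κ) => R t j)
      (rightSpace A m n k ⊔ (rightSpace A m n k).map (shift κ 1))
      (rightSpace A m n (k + 1))

/-- The rows of `L` with index at least `-m` are left essential polynomials: for every
`k ∈ [-m, n + 1]` those with index `k` form a basis of a complement of `N_k^L + z⁻¹ N_k^L` in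
`N_{k-1}^L`.  (For `k = n + 1` this says that they form a basis of `N_n^L`.) -/
def IsLeftEssential (A : ℤ → Matrix ι κ ℂ) (m n : ℕ) (L : Matrix (Fin N) ι ℂ[T;T⁻¹]) : Prop :=
  ∀ k ∈ Finset.Icc (-(m : ℤ)) (n + 1),
    IsComplementBasis (fun (j : {j : Fin N // indices A m n N j = k}) (t : ι) => L j t)
      (leftSpace A m n k ⊔ (leftSpace A m n k).map (shift ι (-1)))
      (leftSpace A m n (k - 1))

/-- `R(z)` is the matrix of a full set of right essential polynomials and `α₋(z)` comes from a
decomposition `A(z) R(z) = α₋(z) d(z) - z^{n+1} β₊(z)`.  If the right defect `ω` is zero, there is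
no index `n + 1`, the last two conditions hold automatically and `R` determines `α₋`.
Otherwise the `ω` missing columns, of index `n + 1`, are complemented by arbitrary polynomials of
formal degree `n + m + 2`; in these columns the decomposition leaves the constant term of `α₋`
free, and these `ω` constant terms have to complement the column space of `(A_{-m} … A_n)`. -/
structure IsFullRightSystem (A : ℤ → Matrix ι κ ℂ) (m n : ℕ)
    (R : Matrix κ (Fin N) ℂ[T;T⁻¹]) (α : Matrix ι (Fin N) ℂ[T;T⁻¹]) : Prop where
  essential : IsRightEssential A m n R
  poly : IsPolyInZInv α
  decomposition : ∃ β : Matrix ι (Fin N) ℂ[T;T⁻¹], IsPolyInZ β ∧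
    genFun A m n * R
      = α * indexDiag (indices A m n N) - (LaurentPolynomial.T ((n : ℤ) + 1) : ℂ[T;T⁻¹]) • β
  complement_degree : ∀ j, indices A m n N j = n + 1 → ∀ t, SupportedIn (R t j) 0 (n + m + 2)
  complement_span :
    Submodule.span ℂ ({v : ι → ℂ | ∃ k ∈ Finset.Icc (-(m : ℤ)) n, ∃ t, v = fun s => A k s t} ∪
      {v : ι → ℂ | ∃ j, indices A m n N j = n + 1 ∧ v = fun s => (α s j).coeff 0}) = ⊤

/-- The mirror image of `IsFullRightSystem`: `L(z)` is the matrix of a full set of left essential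
polynomials, complemented for the index `-m - 1` if the left defect `α` is not zero, and `α₊(z)`
comes from a decomposition `L(z) A(z) = d(z) α₊(z) - z^{-m-1} β₋(z)`. -/
structure IsFullLeftSystem (A : ℤ → Matrix ι κ ℂ) (m n : ℕ)
    (L : Matrix (Fin N) ι ℂ[T;T⁻¹]) (α : Matrix (Fin N) κ ℂ[T;T⁻¹]) : Prop where
  essential : IsLeftEssential A m n L
  poly : IsPolyInZ α
  decomposition : ∃ β : Matrix (Fin N) κ ℂ[T;T⁻¹], IsPolyInZInv β ∧
    L * genFun A m n
      = indexDiag (indices A m n N) * α - (LaurentPolynomial.T (-(m : ℤ) - 1) : ℂ[T;T⁻¹]) • β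
  complement_degree : ∀ j, indices A m n N j = -(m : ℤ) - 1 →
    ∀ t, SupportedIn (L j t) (-(n + m + 2)) 0
  complement_span :
    Submodule.span ℂ ({v : κ → ℂ | ∃ k ∈ Finset.Icc (-(m : ℤ)) n, ∃ s, v = fun t => A k s t} ∪
      {v : κ → ℂ | ∃ j, indices A m n N j = -(m : ℤ) - 1 ∧ v = fun t => (α j t).coeff 0}) = ⊤

/-- `U₋(z)` with the block rows `z^{-m-1} R(z) d(z)⁻¹` and `α₋(z)`. -/
def uMinus (A : ℤ → Matrix ι κ ℂ) (m n : ℕ) (R : Matrix κ (Fin N) ℂ[T;T⁻¹])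
    (α : Matrix ι (Fin N) ℂ[T;T⁻¹]) : Matrix (κ ⊕ ι) (Fin N) ℂ[T;T⁻¹] :=
  Matrix.fromRows ((LaurentPolynomial.T (-(m : ℤ) - 1) : ℂ[T;T⁻¹]) •
    (R * indexDiagInv (indices A m n N))) α

/-- `U₊(z)` with the block columns `α₊(z)` and `z^{n+1} d(z)⁻¹ L(z)`. -/
def uPlus (A : ℤ → Matrix ι κ ℂ) (m n : ℕ) (L : Matrix (Fin N) ι ℂ[T;T⁻¹])
    (α : Matrix (Fin N) κ ℂ[T;T⁻¹]) : Matrix (Fin N) (κ ⊕ ι) ℂ[T;T⁻¹] :=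
  Matrix.fromCols α ((LaurentPolynomial.T ((n : ℤ) + 1) : ℂ[T;T⁻¹]) •
    (indexDiagInv (indices A m n N) * L))

/-- `U₋(z)` is unimodular and `U₋(z)⁻¹ = (*  L(z))`. -/
def IsConformingLeft (A : ℤ → Matrix ι κ ℂ) (m n : ℕ) (R : Matrix κ (Fin N) ℂ[T;T⁻¹])
    (α : Matrix ι (Fin N) ℂ[T;T⁻¹]) (L : Matrix (Fin N) ι ℂ[T;T⁻¹]) : Prop :=
  IsPolyInZInv (uMinus A m n R α) ∧ ∃ V : Matrix (Fin N) (κ ⊕ ι) ℂ[T;T⁻¹],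
    IsPolyInZInv V ∧ uMinus A m n R α * V = 1 ∧ V * uMinus A m n R α = 1 ∧ L = V.toCols₂

/-- `U₊(z)` is unimodular and `U₊(z)⁻¹` has upper block row `R(z)`. -/
def IsConformingRight (A : ℤ → Matrix ι κ ℂ) (m n : ℕ) (L : Matrix (Fin N) ι ℂ[T;T⁻¹])
    (α : Matrix (Fin N) κ ℂ[T;T⁻¹]) (R : Matrix κ (Fin N) ℂ[T;T⁻¹]) : Prop :=
  IsPolyInZ (uPlus A m n L α) ∧ ∃ V : Matrix (κ ⊕ ι) (Fin N) ℂ[T;T⁻¹],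
    IsPolyInZ V ∧ uPlus A m n L α * V = 1 ∧ V * uPlus A m n L α = 1 ∧ R = V.toRows₁

/-- `R(z)` and `L(z)` are matrices of conforming right and left essential polynomials: either one
starts from a full set of right essential polynomials and `L` is recovered from `U₋⁻¹`, or one
starts from a full set of left essential polynomials and `R` is recovered from `U₊⁻¹`. -/
def AreConforming (A : ℤ → Matrix ι κ ℂ) (m n : ℕ) (R : Matrix κ (Fin N) ℂ[T;T⁻¹])
    (L : Matrix (Fin N) ι ℂ[T;T⁻¹]) : Prop :=
  (∃ α, IsFullRightSystem A m n R α ∧ IsConformingLeft A m n R α L) ∨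
    (∃ α, IsFullLeftSystem A m n L α ∧ IsConformingRight A m n L α R)

end Sequence

section Blocks

/-! ### Block matrices

A block matrix with `k × l` blocks has rows indexed by `Fin k × ρ` and columns by `Fin l × τ`. -/

variable {ρ τ : Type} [DecidableEq ρ] {N : ℕ}

/-- The block Toeplitz matrix `(a_{i-j})`, `0 ≤ i ≤ n`, `0 ≤ j ≤ m`. -/
def toeplitz (m n : ℕ) (a : ℤ → Matrix ρ τ ℂ) :
    Matrix (Fin (n + 1) × ρ) (Fin (m + 1) × τ) ℂ :=
  Matrix.of fun x y => a ((x.1 : ℤ) - (y.1 : ℤ)) x.2 y.2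

/-- The block Hankel matrix `(b_{i+j})`, `0 ≤ i ≤ n`, `0 ≤ j ≤ m`. -/
def hankel (m n : ℕ) (b : ℤ → Matrix ρ τ ℂ) :
    Matrix (Fin (n + 1) × ρ) (Fin (m + 1) × τ) ℂ :=
  Matrix.of fun x y => b ((x.1 : ℤ) + (y.1 : ℤ)) x.2 y.2

/-- The lower triangular block Toeplitz matrix with first block column `R_0, …, R_m`. -/
def lowerToeplitz (m : ℕ) (R : Matrix ρ τ ℂ[T;T⁻¹]) :
    Matrix (Fin (m + 1) × ρ) (Fin (m + 1) × τ) ℂ :=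
  Matrix.of fun x y =>
    if y.1 ≤ x.1 then (R x.2 y.2).coeff ((x.1 : ℤ) - (y.1 : ℤ)) else 0

/-- The upper triangular block Toeplitz matrix with first block row `L_0, L_{-1}, …, L_{-n}`. -/
def upperToeplitz (n : ℕ) (L : Matrix ρ τ ℂ[T;T⁻¹]) :
    Matrix (Fin (n + 1) × ρ) (Fin (n + 1) × τ) ℂ :=
  Matrix.of fun x y =>
    if x.1 ≤ y.1 then (L x.2 y.2).coeff ((x.1 : ℤ) - (y.1 : ℤ)) else 0

/-- The block flip `J`, with identity blocks on the block antidiagonal. -/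
def blockFlip (k : ℕ) (ρ : Type) [DecidableEq ρ] : Matrix (Fin (k + 1) × ρ) (Fin (k + 1) × ρ) ℂ :=
  Matrix.of fun x y => if (x.1 : ℕ) + (y.1 : ℕ) = k ∧ x.2 = y.2 then 1 else 0

/-- `Π = (Π_{i-j})`, `0 ≤ i ≤ m`, `0 ≤ j ≤ n`, where `Π_{-λ}` is the diagonal matrix with ones at
the positions of the indices equal to `λ`, and zeros elsewhere. -/
def piMatrix (m n : ℕ) (μ : Fin N → ℤ) :
    Matrix (Fin (m + 1) × Fin N) (Fin (n + 1) × Fin N) ℂ :=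
  toeplitz n m fun k => Matrix.diagonal fun i => if μ i = -k then 1 else 0

end Blocks

/-- The auxiliary sequence `A_j` with blocks `b_{n-j}`, `a_{n-m-j}`, `a_j`, `b_{j+m}`. -/
def auxSeq {p q : ℕ} (m n : ℕ) (a b : ℤ → Matrix (Fin p) (Fin q) ℂ) :
    ℤ → Matrix (Fin p ⊕ Fin p) (Fin q ⊕ Fin q) ℂ :=
  fun j => Matrix.fromBlocks (b (n - j)) (a (n - m - j)) (a j) (b (j + m))

/-- `½ (T_{R1} + s H_{R2}) Π (T_{L2} + s H_{L1})` with `H_{R2} = J T_{R2}`, `H_{L1} = T_{L1} J`;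
the sign `s` is `1` or `-1`. -/
def inversionFormula {p q N : ℕ} (m n : ℕ) (μ : Fin N → ℤ)
    (R : Matrix (Fin q ⊕ Fin q) (Fin N) ℂ[T;T⁻¹]) (L : Matrix (Fin N) (Fin p ⊕ Fin p) ℂ[T;T⁻¹])
    (s : ℂ) : Matrix (Fin (m + 1) × Fin q) (Fin (n + 1) × Fin p) ℂ :=
  (1 / 2 : ℂ) •
    ((lowerToeplitz m R.toRows₁ + s • (blockFlip m (Fin q) * lowerToeplitz m R.toRows₂)) *
      piMatrix m n μ *
      (upperToeplitz n L.toCols₂ + s • (upperToeplitz n L.toCols₁ * blockFlip n (Fin p))))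

end

end ToeplitzHankel

/-!
The inversion formulas come from a Wiener–Hopf factorization. To a sequence `A_{-m}, …, A_n` belongs
the symbol `G(z)` (`symbol`), block lower triangular with diagonal blocks `z^{-m-1}` and `z^{n+1}`
and lower left block `A(z)`. The space `N_k^R` consists of the upper parts of the polynomial vectors
`v` such that `G v` has degree less than `k`, so the dimensions of these spaces are those of the
sections of a vector bundle on the projective line, and the indices are its splitting type.

A full right system is a decomposition `G (R; β₊) = U₋ d` (`symbol_mul_fromRows`). Since the indices
sum up to the order of `det G` (`IsIndexFamily.sum_eq`), the determinants of `(R; β₊)` and `U₋`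
agree. One is a polynomial in `z`, the other in `z⁻¹`, so both are constant, and the constant is not
zero because the leading coefficients of essential polynomials are linearly independent
(`IsRightSystem.eq_zero_of_leading_eq_zero`). So both matrices are unimodular
(`IsRightSystem.exists_inverses`), and with `U₊ = (R; β₊)⁻¹` this is a factorization `G = U₋ d U₊`.
Full right systems exist because the number of indices of each value is the dimension of the
complement that is needed (`IsIndexFamily.card_fiber`, `IsIndexFamily.card_top`), which rests on
the monotonicity of the dimension increments and on rank–nullity. The left theory is the right
theory of the sequence `A_{-k}ᵀ`, for the substitution `z ↦ z⁻¹` (`isFullLeftSystem_iff`).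

Block Toeplitz matrices are truncated multiplications, and a factorization `G = U₋ d U₊` makes
`X = T_R Π T_L` a generalized inverse of the block Toeplitz matrix `K = (A_{i-j})`
(`ComeFromFactorization.toeplitz_mul`): for a polynomial `x` of degree at most `m`, with
`A x = y + z^{n+1} u +` negative powers and `f = U₊ (x; -u)`, the vector `X y` is `x - R g`, where
`g` collects the terms of `f` which `d` maps to negative powers; then `G U₊⁻¹ g = U₋ d g` has only
negative powers, so `K` annihilates `R g`.

For the auxiliary sequence of `T` and `H`, the matrix `K` is `diag(J, 1) (H T; T H) diag(1, J)` up
to a permutation, and the generalized inverse of `K` compresses to those of `T ± H`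
(`mul_compression_mul`).
-/

namespace ToeplitzHankel

noncomputable section

set_option linter.unusedSectionVars false
set_option linter.unnecessarySeqFocus false

/-! ### Supports of Laurent polynomials -/

/-- Only powers `z ^ k` with `a ≤ k` occur in `f`. -/
def OrderGE (a : ℤ) (f : ℂ[T;T⁻¹]) : Prop := ∀ k, k < a → f.coeff k = 0

/-- Only powers `z ^ k` with `k ≤ b` occur in `f`. -/
def DegLE (b : ℤ) (f : ℂ[T;T⁻¹]) : Prop := ∀ k, b < k → f.coeff k = 0

lemma coeff_mul_eq_sum (f g : ℂ[T;T⁻¹]) (k : ℤ) :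
    (f * g).coeff k = f.coeff.sum fun i c => c * g.coeff (k - i) := by
  induction f using AddMonoidAlgebra.induction_linear with
  | zero => simp
  | add f₁ f₂ h₁ h₂ =>
    rw [add_mul, AddMonoidAlgebra.coeff_add, Finsupp.add_apply, h₁, h₂,
      AddMonoidAlgebra.coeff_add, Finsupp.sum_add_index'] <;> intros <;> ring
  | single i c =>
    have h := AddMonoidAlgebra.coeff_single_mul_apply g c i k
    rw [h, AddMonoidAlgebra.coeff_single, Finsupp.sum_single_index (by simp), sub_eq_neg_add]

@[simp] lemma coeff_T_mul (s : ℤ) (f : ℂ[T;T⁻¹]) (k : ℤ) :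
    (LaurentPolynomial.T s * f).coeff k = f.coeff (k - s) := by
  rw [coeff_mul_eq_sum, LaurentPolynomial.T, AddMonoidAlgebra.coeff_single,
    Finsupp.sum_single_index (by simp), one_mul]

@[simp] lemma coeff_C_mul (c : ℂ) (f : ℂ[T;T⁻¹]) (k : ℤ) :
    (LaurentPolynomial.C c * f).coeff k = c * f.coeff k := by
  rw [← LaurentPolynomial.smul_eq_C_mul]
  simp

@[simp] lemma coeff_mul_T (f : ℂ[T;T⁻¹]) (s : ℤ) (k : ℤ) :
    (f * LaurentPolynomial.T s).coeff k = f.coeff (k - s) := by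
  rw [mul_comm, coeff_T_mul]

lemma coeff_finset_sum {τ : Type*} (S : Finset τ) (f : τ → ℂ[T;T⁻¹]) (k : ℤ) :
    (∑ i ∈ S, f i).coeff k = ∑ i ∈ S, (f i).coeff k := by
  rw [AddMonoidAlgebra.coeff_sum, Finsupp.finsetSum_apply]

lemma coeff_neg' (f : ℂ[T;T⁻¹]) (k : ℤ) : (-f).coeff k = -f.coeff k := rfl

lemma coeff_sub' (f g : ℂ[T;T⁻¹]) (k : ℤ) : (f - g).coeff k = f.coeff k - g.coeff k := rfl

lemma coeff_add' (f g : ℂ[T;T⁻¹]) (k : ℤ) : (f + g).coeff k = f.coeff k + g.coeff k := rfl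

namespace OrderGE

variable {a b : ℤ} {f g : ℂ[T;T⁻¹]}

lemma mono (h : OrderGE a f) (hab : b ≤ a) : OrderGE b f := fun k hk => h k (by omega)

lemma zero : OrderGE a 0 := fun _ _ => rfl

lemma add (hf : OrderGE a f) (hg : OrderGE a g) : OrderGE a (f + g) := fun k hk => by
  rw [coeff_add', hf k hk, hg k hk, add_zero]

lemma neg (hf : OrderGE a f) : OrderGE a (-f) := fun k hk => by
  rw [coeff_neg', hf k hk, neg_zero]

lemma sub (hf : OrderGE a f) (hg : OrderGE a g) : OrderGE a (f - g) := fun k hk => by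
  rw [coeff_sub', hf k hk, hg k hk, sub_zero]

lemma sum {τ : Type*} {S : Finset τ} {f : τ → ℂ[T;T⁻¹]} (h : ∀ i ∈ S, OrderGE a (f i)) :
    OrderGE a (∑ i ∈ S, f i) := fun k hk => by
  rw [coeff_finset_sum]
  exact Finset.sum_eq_zero fun i hi => h i hi k hk

lemma mul (hf : OrderGE a f) (hg : OrderGE b g) : OrderGE (a + b) (f * g) := fun k hk => by
  rw [coeff_mul_eq_sum]
  refine Finset.sum_eq_zero fun i _ => ?_
  by_cases h : i < a
  · simp [hf i h]
  · simp [hg (k - i) (by omega)]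

lemma C_mul (c : ℂ) (hf : OrderGE a f) : OrderGE a (LaurentPolynomial.C c * f) := fun k hk => by
  rw [coeff_C_mul, hf k hk, mul_zero]

lemma T_mul (s : ℤ) (hf : OrderGE a f) : OrderGE (a + s) (LaurentPolynomial.T s * f) :=
  fun k hk => by rw [coeff_T_mul, hf _ (by omega)]

lemma one : OrderGE 0 (1 : ℂ[T;T⁻¹]) := fun k hk => by
  rw [← LaurentPolynomial.T_zero, LaurentPolynomial.T_apply, if_neg (by omega)]

lemma C (c : ℂ) : OrderGE 0 (LaurentPolynomial.C c) := fun k hk => by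
  rw [LaurentPolynomial.C_apply, if_neg (by omega)]

end OrderGE

namespace DegLE

variable {a b : ℤ} {f g : ℂ[T;T⁻¹]}

lemma mono (h : DegLE a f) (hab : a ≤ b) : DegLE b f := fun k hk => h k (by omega)

lemma zero : DegLE a 0 := fun _ _ => rfl

lemma add (hf : DegLE a f) (hg : DegLE a g) : DegLE a (f + g) := fun k hk => by
  rw [coeff_add', hf k hk, hg k hk, add_zero]

lemma neg (hf : DegLE a f) : DegLE a (-f) := fun k hk => by
  rw [coeff_neg', hf k hk, neg_zero]

lemma sum {τ : Type*} {S : Finset τ} {f : τ → ℂ[T;T⁻¹]} (h : ∀ i ∈ S, DegLE a (f i)) :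
    DegLE a (∑ i ∈ S, f i) := fun k hk => by
  rw [coeff_finset_sum]
  exact Finset.sum_eq_zero fun i hi => h i hi k hk

lemma mul (hf : DegLE a f) (hg : DegLE b g) : DegLE (a + b) (f * g) := fun k hk => by
  rw [coeff_mul_eq_sum]
  refine Finset.sum_eq_zero fun i _ => ?_
  by_cases h : a < i
  · simp [hf i h]
  · simp [hg (k - i) (by omega)]

lemma C_mul (c : ℂ) (hf : DegLE a f) : DegLE a (LaurentPolynomial.C c * f) := fun k hk => by
  rw [coeff_C_mul, hf k hk, mul_zero]

lemma T_mul (s : ℤ) (hf : DegLE a f) : DegLE (a + s) (LaurentPolynomial.T s * f) :=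
  fun k hk => by rw [coeff_T_mul, hf _ (by omega)]

lemma one : DegLE 0 (1 : ℂ[T;T⁻¹]) := fun k hk => by
  rw [← LaurentPolynomial.T_zero, LaurentPolynomial.T_apply, if_neg (by omega)]

lemma C (c : ℂ) : DegLE 0 (LaurentPolynomial.C c) := fun k hk => by
  rw [LaurentPolynomial.C_apply, if_neg (by omega)]

/-- Constant terms of polynomials in `z⁻¹` multiply. -/
lemma coeff_zero_mul (hf : DegLE 0 f) (hg : DegLE 0 g) :
    (f * g).coeff 0 = f.coeff 0 * g.coeff 0 := by
  rw [coeff_mul_eq_sum]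
  refine (Finset.sum_eq_single 0 (fun i _ hi => ?_) fun h => ?_).trans (by simp)
  · change f.coeff i * g.coeff (0 - i) = 0
    rcases lt_or_gt_of_ne hi with h | h
    · rw [hg (0 - i) (by omega), mul_zero]
    · rw [hf i h, zero_mul]
  · simp [Finsupp.notMem_support_iff.mp h]

end DegLE

lemma eq_C_of_orderGE_of_degLE {f : ℂ[T;T⁻¹]} (h₁ : OrderGE 0 f) (h₂ : DegLE 0 f) :
    f = LaurentPolynomial.C (f.coeff 0) := by
  ext k
  rw [LaurentPolynomial.C_apply]
  rcases lt_trichotomy k 0 with h | h | h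
  · rw [if_neg h.ne, h₁ k h]
  · rw [if_pos h, h]
  · rw [if_neg h.ne', h₂ k h]

lemma degLE_invert {a : ℤ} {f : ℂ[T;T⁻¹]} :
    DegLE a (LaurentPolynomial.invert f) ↔ OrderGE (-a) f := by
  refine ⟨fun h k hk => ?_, fun h k hk => ?_⟩
  · simpa using h (-k) (by omega)
  · simpa using h (-k) (by omega)

lemma orderGE_invert {a : ℤ} {f : ℂ[T;T⁻¹]} :
    OrderGE a (LaurentPolynomial.invert f) ↔ DegLE (-a) f := by
  refine ⟨fun h k hk => ?_, fun h k hk => ?_⟩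
  · simpa using h (-k) (by omega)
  · simpa using h (-k) (by omega)

lemma supportedIn_iff {f : ℂ[T;T⁻¹]} {a b : ℤ} :
    SupportedIn f a b ↔ OrderGE a f ∧ DegLE b f := by
  refine ⟨fun h => ⟨fun k hk => ?_, fun k hk => ?_⟩, fun h k hk => ⟨?_, ?_⟩⟩
  · by_contra h'; have := (h k h').1; omega
  · by_contra h'; have := (h k h').2; omega
  · by_contra h'; exact hk (h.1 k (by omega))
  · by_contra h'; exact hk (h.2 k (by omega))

lemma isPolyInZ_iff {ι κ : Type} {M : Matrix ι κ ℂ[T;T⁻¹]} :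
    IsPolyInZ M ↔ ∀ i j, OrderGE 0 (M i j) := by
  refine ⟨fun h i j k hk => ?_, fun h i j k hk => ?_⟩
  · by_contra h'; have := h i j k h'; omega
  · by_contra h'; exact hk (h i j k (by omega))

lemma isPolyInZInv_iff {ι κ : Type} {M : Matrix ι κ ℂ[T;T⁻¹]} :
    IsPolyInZInv M ↔ ∀ i j, DegLE 0 (M i j) := by
  refine ⟨fun h i j k hk => ?_, fun h i j k hk => ?_⟩
  · by_contra h'; have := h i j k h'; omega
  · by_contra h'; exact hk (h i j k (by omega))

lemma OrderGE.mulVec {ι κ : Type} [Fintype κ] {M : Matrix ι κ ℂ[T;T⁻¹]} {v : κ → ℂ[T;T⁻¹]}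
    {a b : ℤ} (hM : ∀ i j, OrderGE a (M i j)) (hv : ∀ j, OrderGE b (v j)) (i : ι) :
    OrderGE (a + b) (M.mulVec v i) :=
  OrderGE.sum fun j _ => (hM i j).mul (hv j)

lemma DegLE.mulVec {ι κ : Type} [Fintype κ] {M : Matrix ι κ ℂ[T;T⁻¹]} {v : κ → ℂ[T;T⁻¹]}
    {a b : ℤ} (hM : ∀ i j, DegLE a (M i j)) (hv : ∀ j, DegLE b (v j)) (i : ι) :
    DegLE (a + b) (M.mulVec v i) :=
  DegLE.sum fun j _ => (hM i j).mul (hv j)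

/-- The part of `f` made of the powers `z ^ k` with `k < a`. -/
def truncLT (a : ℤ) (f : ℂ[T;T⁻¹]) : ℂ[T;T⁻¹] :=
  AddMonoidAlgebra.ofCoeff (f.coeff.filter fun k => k < a)

lemma coeff_truncLT (a : ℤ) (f : ℂ[T;T⁻¹]) (k : ℤ) :
    (truncLT a f).coeff k = if k < a then f.coeff k else 0 := by
  simp [truncLT, Finsupp.filter_apply]

lemma degLE_truncLT (a : ℤ) (f : ℂ[T;T⁻¹]) : DegLE (a - 1) (truncLT a f) := fun k hk => by
  rw [coeff_truncLT, if_neg (by omega)]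

lemma orderGE_sub_truncLT (a : ℤ) (f : ℂ[T;T⁻¹]) : OrderGE a (f - truncLT a f) := fun k hk => by
  rw [coeff_sub', coeff_truncLT, if_pos hk, sub_self]

/-- The polynomials in `z`, as a subring of the Laurent polynomials. -/
def polySubring : Subring ℂ[T;T⁻¹] where
  carrier := {f | OrderGE 0 f}
  zero_mem' := OrderGE.zero
  one_mem' := OrderGE.one
  add_mem' h₁ h₂ := OrderGE.add h₁ h₂
  neg_mem' h := OrderGE.neg h
  mul_mem' h₁ h₂ := by simpa using OrderGE.mul h₁ h₂

/-- The polynomials in `z⁻¹`, as a subring of the Laurent polynomials. -/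
def polyInvSubring : Subring ℂ[T;T⁻¹] where
  carrier := {f | DegLE 0 f}
  zero_mem' := DegLE.zero
  one_mem' := DegLE.one
  add_mem' h₁ h₂ := DegLE.add h₁ h₂
  neg_mem' h := DegLE.neg h
  mul_mem' h₁ h₂ := by simpa using DegLE.mul h₁ h₂

/-- The value at infinity of a polynomial in `z⁻¹`. -/
def valueAtInfinity : polyInvSubring →+* ℂ where
  toFun f := f.1.coeff 0
  map_zero' := rfl
  map_one' := by
    change (1 : ℂ[T;T⁻¹]).coeff 0 = 1
    rw [← LaurentPolynomial.T_zero, LaurentPolynomial.T_apply, if_pos rfl]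
  map_add' _ _ := rfl
  map_mul' f g := DegLE.coeff_zero_mul f.2 g.2

lemma det_mem_of_forall_mem {ι : Type} [Fintype ι] [DecidableEq ι] (S : Subring ℂ[T;T⁻¹])
    {M : Matrix ι ι ℂ[T;T⁻¹]} (h : ∀ i j, M i j ∈ S) : M.det ∈ S := by
  rw [Matrix.det_apply]
  exact S.sum_mem fun σ _ => by
    rw [Units.smul_def]
    exact S.zsmul_mem (S.prod_mem fun i _ => h _ _) _

lemma adjugate_mem_of_forall_mem {ι : Type} [Fintype ι] [DecidableEq ι] (S : Subring ℂ[T;T⁻¹])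
    {M : Matrix ι ι ℂ[T;T⁻¹]} (h : ∀ i j, M i j ∈ S) (i j : ι) : M.adjugate i j ∈ S := by
  rw [Matrix.adjugate_apply]
  refine det_mem_of_forall_mem S fun x y => ?_
  rw [Matrix.updateRow_apply]
  split_ifs
  · rw [Pi.single_apply]
    split_ifs
    exacts [S.one_mem, S.zero_mem]
  · exact h x y

lemma coeff_zero_det {ι : Type} [Fintype ι] [DecidableEq ι] {M : Matrix ι ι ℂ[T;T⁻¹]}
    (h : ∀ i j, DegLE 0 (M i j)) :
    M.det.coeff 0 = (Matrix.of fun i j => (M i j).coeff 0).det := by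
  let M' : Matrix ι ι polyInvSubring := Matrix.of fun i j => ⟨M i j, h i j⟩
  have h₁ : M.det = (M'.det : ℂ[T;T⁻¹]) := by
    have := polyInvSubring.subtype.map_det M'
    exact this.symm ▸ rfl
  have h₂ := valueAtInfinity.map_det M'
  rw [h₁]
  exact h₂

section Spaces

/-! ### The spaces of right and left polynomials -/

variable {ι κ : Type} [Fintype ι] [Fintype κ]
  {A : ℤ → Matrix ι κ ℂ} {m n : ℕ}

lemma coeff_genFun (i : ι) (j : κ) (k : ℤ) :
    (genFun A m n i j).coeff k = if k ∈ Finset.Icc (-(m : ℤ)) n then A k i j else 0 := by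
  simp only [genFun, Matrix.of_apply, coeff_finset_sum, coeff_C_mul, LaurentPolynomial.T_apply]
  simp

/-- A coefficient of a product with `A(z)`, as a sum over the coefficients of `A(z)`. -/
lemma coeff_genFun_mul (i : ι) (j : κ) (f : ℂ[T;T⁻¹]) (k : ℤ) :
    (genFun A m n i j * f).coeff k =
      ∑ l ∈ Finset.Icc (-(m : ℤ)) n, A l i j * f.coeff (k - l) := by
  simp only [genFun, Matrix.of_apply, Finset.sum_mul, coeff_finset_sum, mul_assoc, coeff_C_mul,
    coeff_T_mul]

lemma sum_Icc_neg {M : Type*} [AddCommMonoid M] (f : ℤ → M) (a b : ℤ) :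
    ∑ j ∈ Finset.Icc a b, f (-j) = ∑ l ∈ Finset.Icc (-b) (-a), f l := by
  refine Finset.sum_nbij' (fun j => -j) (fun j => -j) ?_ ?_ ?_ ?_ ?_ <;> intros <;>
    simp_all [Finset.mem_Icc] <;> omega

lemma sigmaR_shift (r : κ → ℂ[T;T⁻¹]) (i : ℤ) (s : ι) :
    sigmaR A m n (shift κ (-i) r) s = ((genFun A m n).mulVec r s).coeff i := by
  have h := sum_Icc_neg (fun l => Matrix.mulVec (A l) (fun t => (r t).coeff (i - l)) s)
    (-(n : ℤ)) m
  rw [neg_neg] at h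
  simp only [Matrix.mulVec, dotProduct, coeff_finset_sum, coeff_genFun_mul]
  rw [Finset.sum_comm]
  refine Eq.trans ?_ h
  simp [sigmaR, shift, Finset.sum_apply, sub_eq_add_neg, add_comm]

lemma sigmaL_shift (l : ι → ℂ[T;T⁻¹]) (i : ℤ) (t : κ) :
    sigmaL A m n (shift ι (-i) l) t = (Matrix.vecMul l (genFun A m n) t).coeff i := by
  have h := sum_Icc_neg (fun k => Matrix.vecMul (fun s => (l s).coeff (i - k)) (A k) t)
    (-(n : ℤ)) m
  rw [neg_neg] at h
  simp only [Matrix.vecMul, dotProduct, coeff_finset_sum, mul_comm (l _), coeff_genFun_mul]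
  rw [Finset.sum_comm]
  simp only [mul_comm (A _ _ _)]
  refine Eq.trans ?_ h
  simp [sigmaL, shift, Finset.sum_apply, sub_eq_add_neg, add_comm]

lemma mem_rightSpace {k : ℤ} {r : κ → ℂ[T;T⁻¹]} :
    r ∈ rightSpace A m n k ↔ ((∀ t, OrderGE 0 (r t)) ∧ ∀ t, DegLE (k + m) (r t)) ∧
      ∀ i, k ≤ i → i ≤ n → ∀ s, ((genFun A m n).mulVec r s).coeff i = 0 := by
  change ((∀ t, SupportedIn (r t) 0 (k + m)) ∧
    ∀ i ∈ Finset.Icc k (n : ℤ), sigmaR A m n (shift κ (-i) r) = 0) ↔ _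
  simp only [supportedIn_iff, forall_and, funext_iff, sigmaR_shift, Finset.mem_Icc, and_imp,
    Pi.zero_apply]

lemma mem_leftSpace {k : ℤ} {l : ι → ℂ[T;T⁻¹]} :
    l ∈ leftSpace A m n k ↔ ((∀ s, OrderGE (k - n) (l s)) ∧ ∀ s, DegLE 0 (l s)) ∧
      ∀ i, -(m : ℤ) ≤ i → i ≤ k → ∀ t, (Matrix.vecMul l (genFun A m n) t).coeff i = 0 := by
  change ((∀ t, SupportedIn (l t) (k - n) 0) ∧
    ∀ i ∈ Finset.Icc (-(m : ℤ)) k, sigmaL A m n (shift ι (-i) l) = 0) ↔ _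
  simp only [supportedIn_iff, forall_and, funext_iff, sigmaL_shift, Finset.mem_Icc, and_imp,
    Pi.zero_apply]

lemma shift_apply (s : ℤ) (r : κ → ℂ[T;T⁻¹]) (t : κ) :
    shift κ s r t = LaurentPolynomial.T s * r t := rfl

lemma coeff_mulVec_shift (F : Matrix ι κ ℂ[T;T⁻¹]) (s : ℤ) (r : κ → ℂ[T;T⁻¹]) (i : ι) (k : ℤ) :
    (F.mulVec (shift κ s r) i).coeff k = (F.mulVec r i).coeff (k - s) := by
  have : F.mulVec (shift κ s r) i = LaurentPolynomial.T s * F.mulVec r i := by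
    simp only [Matrix.mulVec, dotProduct, shift_apply, Finset.mul_sum]
    exact Finset.sum_congr rfl fun _ _ => by ring
  rw [this, coeff_T_mul]

lemma shift_injective (s : ℤ) : Function.Injective (shift κ s) := by
  intro x y h
  funext t
  have := congrFun h t
  rw [shift_apply, shift_apply] at this
  exact (LaurentPolynomial.isUnit_T s).mul_left_cancel this

lemma shift_mem_rightSpace {k l : ℤ} (hl : 0 ≤ l) {r : κ → ℂ[T;T⁻¹]}
    (hr : r ∈ rightSpace A m n k) : shift κ l r ∈ rightSpace A m n (k + l) := by
  rw [mem_rightSpace] at hr ⊢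
  refine ⟨⟨fun t => ((hr.1.1 t).T_mul l).mono (by omega), fun t =>
    ((hr.1.2 t).T_mul l).mono (by omega)⟩, fun i h₁ h₂ s => ?_⟩
  rw [coeff_mulVec_shift]
  exact hr.2 _ (by omega) (by omega) s

lemma rightSpace_mono {k l : ℤ} (h : k ≤ l) : rightSpace A m n k ≤ rightSpace A m n l := by
  intro r hr
  rw [mem_rightSpace] at hr ⊢
  exact ⟨⟨hr.1.1, fun t => (hr.1.2 t).mono (by omega)⟩, fun i h₁ h₂ s => hr.2 i (by omega) h₂ s⟩

lemma sup_shift_le (k : ℤ) :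
    rightSpace A m n k ⊔ (rightSpace A m n k).map (shift κ 1) ≤ rightSpace A m n (k + 1) := by
  refine sup_le (rightSpace_mono (by omega)) ?_
  rintro _ ⟨r, hr, rfl⟩
  exact shift_mem_rightSpace zero_le_one hr

lemma inf_shift (k : ℤ) (hk : k ≤ n) :
    rightSpace A m n k ⊓ (rightSpace A m n k).map (shift κ 1) =
      (rightSpace A m n (k - 1)).map (shift κ 1) := by
  refine le_antisymm ?_ (le_inf ?_ (Submodule.map_mono (rightSpace_mono (by omega))))
  · rintro _ ⟨h, r, hr, rfl⟩
    refine ⟨r, ?_, rfl⟩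
    rw [SetLike.mem_coe, mem_rightSpace] at hr h ⊢
    refine ⟨⟨hr.1.1, fun t j hj => ?_⟩, fun i h₁ h₂ s => ?_⟩
    · have := h.1.2 t (j + 1) (by omega)
      rwa [shift_apply, coeff_T_mul, add_sub_cancel_right] at this
    · by_cases hi : i = k - 1
      · have := h.2 k le_rfl hk s
        rwa [coeff_mulVec_shift, ← hi] at this
      · exact hr.2 i (by omega) h₂ s
  · have := (sup_shift_le (A := A) (m := m) (n := n) (k - 1))
    rw [sub_add_cancel] at this
    exact le_sup_right.trans this

end Spaces

section Dimensions

/-! ### Dimensions and indices -/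

variable {ι κ : Type} [Fintype ι] [Fintype κ]
  {A : ℤ → Matrix ι κ ℂ} {m n : ℕ}

/-- The vector polynomial with given block coefficients. -/
def polyOfCoeffs (κ : Type) (c : ℕ) : (Fin c × κ → ℂ) →ₗ[ℂ] (κ → ℂ[T;T⁻¹]) where
  toFun x t := ∑ i : Fin c, LaurentPolynomial.C (x (i, t)) * LaurentPolynomial.T (i : ℤ)
  map_add' x y := by
    funext t
    simp [add_mul, Finset.sum_add_distrib]
  map_smul' a x := by
    funext t
    simp [Finset.smul_sum, LaurentPolynomial.smul_eq_C_mul, mul_assoc]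

lemma polyOfCoeffs_apply {c : ℕ} (x : Fin c × κ → ℂ) (t : κ) : polyOfCoeffs κ c x t =
    ∑ i : Fin c, LaurentPolynomial.C (x (i, t)) * LaurentPolynomial.T (i : ℤ) := rfl

lemma coeff_polyOfCoeffs {c : ℕ} (x : Fin c × κ → ℂ) (t : κ) (i : Fin c) :
    (polyOfCoeffs κ c x t).coeff i = x (i, t) := by
  simp only [polyOfCoeffs_apply, coeff_finset_sum, coeff_C_mul, LaurentPolynomial.T_apply]
  simp [Fin.val_inj]

lemma orderGE_polyOfCoeffs {c : ℕ} (x : Fin c × κ → ℂ) (t : κ) :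
    OrderGE 0 (polyOfCoeffs κ c x t) := by
  refine OrderGE.sum fun i _ => OrderGE.C_mul _ fun k hk => ?_
  rw [LaurentPolynomial.T_apply, if_neg (by omega)]

lemma degLE_polyOfCoeffs {c : ℕ} (x : Fin c × κ → ℂ) (t : κ) :
    DegLE (c - 1) (polyOfCoeffs κ c x t) := by
  refine DegLE.sum fun i _ => DegLE.C_mul _ fun k hk => ?_
  rw [LaurentPolynomial.T_apply, if_neg (by omega)]

lemma polyOfCoeffs_injective (c : ℕ) : Function.Injective (polyOfCoeffs κ c) := by
  intro x y h
  funext ⟨i, t⟩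
  rw [← coeff_polyOfCoeffs x t i, h, coeff_polyOfCoeffs]

/-- The block coefficients of `1, z, …, z ^ (c - 1)` in a Laurent vector polynomial. -/
def coeffVec (c : ℕ) (f : κ → ℂ[T;T⁻¹]) : Fin c × κ → ℂ := fun x => (f x.2).coeff (x.1 : ℤ)

lemma coeff_polyOfCoeffs_coeffVec {c : ℕ} (f : κ → ℂ[T;T⁻¹]) (t : κ) {k : ℤ} (h₀ : 0 ≤ k)
    (h₁ : k < c) : (polyOfCoeffs κ c (coeffVec c f) t).coeff k = (f t).coeff k := by
  lift k to ℕ using h₀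
  exact coeff_polyOfCoeffs (coeffVec c f) t ⟨k, by omega⟩

lemma polyOfCoeffs_coeffVec {c : ℕ} {f : κ → ℂ[T;T⁻¹]} (h₀ : ∀ t, OrderGE 0 (f t))
    (h₁ : ∀ t, DegLE (c - 1) (f t)) : polyOfCoeffs κ c (coeffVec c f) = f := by
  funext t
  ext k
  by_cases hk : 0 ≤ k
  · by_cases hk' : k < c
    · exact coeff_polyOfCoeffs_coeffVec f t hk hk'
    · rw [degLE_polyOfCoeffs _ t k (by omega), h₁ t k (by omega)]
  · rw [orderGE_polyOfCoeffs _ t k (by omega), h₀ t k (by omega)]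

/-- The coefficients of a product with the polynomial with coefficients `x`. -/
lemma coeff_mulVec_polyOfCoeffs {c : ℕ} (F : Matrix ι κ ℂ[T;T⁻¹]) (x : Fin c × κ → ℂ) (s : ι)
    (k : ℤ) : (F.mulVec (polyOfCoeffs κ c x) s).coeff k =
      ∑ y : Fin c × κ, (F s y.2).coeff (k - y.1) * x y := by
  rw [Fintype.sum_prod_type_right]
  simp only [Matrix.mulVec, dotProduct, coeff_finset_sum, polyOfCoeffs_apply, Finset.mul_sum]
  refine Finset.sum_congr rfl fun t _ => Finset.sum_congr rfl fun i _ => ?_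
  rw [mul_left_comm, coeff_C_mul, coeff_mul_T, mul_comm]

lemma finrank_map_of_injective {V W : Type} [AddCommGroup V] [Module ℂ V] [AddCommGroup W]
    [Module ℂ W] {f : V →ₗ[ℂ] W} (hf : Function.Injective f) (S : Submodule ℂ V) :
    Module.finrank ℂ (S.map f) = Module.finrank ℂ S :=
  (Submodule.equivMapOfInjective f hf S).finrank_eq.symm

/-- The block Toeplitz matrix with `r × c` blocks `A_{k+i-j}`.  For `r = n + 1 - k`,
`c = k + m + 1` its kernel is `rightSpace A m n k`. -/
def sectionMatrix (A : ℤ → Matrix ι κ ℂ) (k : ℤ) (r c : ℕ) :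
    Matrix (Fin r × ι) (Fin c × κ) ℂ :=
  Matrix.of fun x y => A (k + x.1 - y.1) x.2 y.2

lemma rightSpace_eq_map_ker {k : ℤ} {r c : ℕ} (hr : (r : ℤ) = n + 1 - k)
    (hc : (c : ℤ) = k + m + 1) : rightSpace A m n k =
      (LinearMap.ker (sectionMatrix A k r c).mulVecLin).map (polyOfCoeffs κ c) := by
  have key : ∀ (x : Fin c × κ → ℂ) (i : Fin r) (s : ι),
      (sectionMatrix A k r c).mulVec x (i, s) =
        ((genFun A m n).mulVec (polyOfCoeffs κ c x) s).coeff (k + i) := by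
    intro x i s
    rw [coeff_mulVec_polyOfCoeffs]
    refine Finset.sum_congr rfl fun y _ => ?_
    rw [coeff_genFun, if_pos]
    · rfl
    · simp only [Finset.mem_Icc]
      omega
  ext f
  rw [mem_rightSpace]
  constructor
  · rintro ⟨⟨h₁, h₂⟩, h₃⟩
    have hf : polyOfCoeffs κ c (coeffVec c f) = f :=
      polyOfCoeffs_coeffVec h₁ fun t => (h₂ t).mono (by omega)
    refine ⟨coeffVec c f, ?_, hf⟩
    rw [SetLike.mem_coe, LinearMap.mem_ker, Matrix.mulVecLin_apply]
    funext ⟨i, s⟩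
    rw [key, hf]
    exact h₃ _ (by omega) (by omega) s
  · rintro ⟨x, hx, rfl⟩
    refine ⟨⟨orderGE_polyOfCoeffs x, fun t => (degLE_polyOfCoeffs x t).mono (by omega)⟩,
      fun i h₁ h₂ s => ?_⟩
    rw [SetLike.mem_coe, LinearMap.mem_ker, Matrix.mulVecLin_apply] at hx
    have := congrFun hx (⟨(i - k).toNat, by omega⟩, s)
    rw [key] at this
    rwa [show k + (((i - k).toNat : ℕ) : ℤ) = i by omega] at this

instance finiteDimensional_rightSpace (k : ℤ) : FiniteDimensional ℂ (rightSpace A m n k) := by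
  have h : rightSpace A m n k ≤ LinearMap.range (polyOfCoeffs κ (k + m + 1).toNat) := by
    intro f hf
    rw [mem_rightSpace] at hf
    refine ⟨coeffVec _ f, polyOfCoeffs_coeffVec hf.1.1 fun t j hj => ?_⟩
    by_cases h : 0 ≤ j
    · exact hf.1.2 t j (by omega)
    · exact hf.1.1 t j (by omega)
  exact Submodule.finiteDimensional_of_le h

lemma finrank_rightSpace_add_rank {k : ℤ} {r c : ℕ} (hr : (r : ℤ) = n + 1 - k)
    (hc : (c : ℤ) = k + m + 1) :
    Module.finrank ℂ (rightSpace A m n k) + (sectionMatrix A k r c).rank =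
      c * Fintype.card κ := by
  rw [rightSpace_eq_map_ker hr hc,
    finrank_map_of_injective (polyOfCoeffs_injective c), Matrix.rank, add_comm,
    LinearMap.finrank_range_add_finrank_ker]
  simp

lemma rightSpace_eq_bot {k : ℤ} (hk : k < -m) : rightSpace A m n k = ⊥ := by
  rw [eq_bot_iff]
  intro f hf
  rw [mem_rightSpace] at hf
  rw [Submodule.mem_bot]
  funext t
  ext j
  by_cases h : 0 ≤ j
  · exact hf.1.2 t j (by omega)
  · exact hf.1.1 t j (by omega)

lemma finrank_sup_shift (k : ℤ) (hk : k ≤ n) :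
    Module.finrank ℂ
        ↥(rightSpace A m n k ⊔ (rightSpace A m n k).map (shift κ 1)) +
      Module.finrank ℂ (rightSpace A m n (k - 1)) = 2 * Module.finrank ℂ (rightSpace A m n k) := by
  have h := Submodule.finrank_sup_add_finrank_inf_eq (rightSpace A m n k)
    ((rightSpace A m n k).map (shift κ 1))
  rw [inf_shift k hk, finrank_map_of_injective (shift_injective 1),
   finrank_map_of_injective (shift_injective 1)] at h
  omega

end Dimensions

section Indices

variable {ι κ : Type} [Fintype ι] [Fintype κ]
  {A : ℤ → Matrix ι κ ℂ} {m n N : ℕ}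

lemma rightIncrement_nonneg (k : ℤ) : 0 ≤ rightIncrement A m n k := by
  have := Submodule.finrank_mono (rightSpace_mono (A := A) (m := m) (n := n)
    (show k - 1 ≤ k by omega))
  rw [rightIncrement]
  omega

/-- The increments grow, since `N_k + z N_k` is contained in `N_{k+1}` and has dimension
`2 dim N_k - dim N_{k-1}`. -/
lemma rightIncrement_le_succ {k : ℤ} (hk : k ≤ n) :
    rightIncrement A m n k ≤ rightIncrement A m n (k + 1) := by
  have h₁ := finrank_sup_shift (A := A) (m := m) k hk
  have h₂ := Submodule.finrank_mono (sup_shift_le (A := A) (m := m) (n := n) k)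
  rw [rightIncrement, rightIncrement, add_sub_cancel_right]
  omega

lemma rightIncrement_mono {k l : ℤ} (hkl : k ≤ l) (hl : l ≤ n + 1) :
    rightIncrement A m n k ≤ rightIncrement A m n l := by
  induction l, hkl using Int.leInduction with
  | base => rfl
  | succ l _ ih => exact (ih (by omega)).trans (rightIncrement_le_succ (by omega))

lemma rightIncrement_of_lt {k : ℤ} (hk : k < -m) : rightIncrement A m n k = 0 := by
  rw [rightIncrement, rightSpace_eq_bot hk, rightSpace_eq_bot (by omega), sub_self]

/-- The sequence of the transposes `A_{-k}ᵀ`.  Transposition combined with `z ↦ z⁻¹` interchanges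
the right theory of `A` and the left theory of this sequence. -/
def dualSeq (A : ℤ → Matrix ι κ ℂ) : ℤ → Matrix κ ι ℂ := fun k => (A (-k)).transpose

lemma sectionMatrix_dualSeq (k : ℤ) (r c : ℕ) :
    sectionMatrix (dualSeq A) (-k) c r = (sectionMatrix A k r c).transpose := by
  ext x y
  simp only [sectionMatrix, dualSeq, Matrix.of_apply, Matrix.transpose_apply]
  congr 1
  ring

/-- A block Toeplitz matrix and its transpose have the same rank. -/
lemma finrank_rightSpace_dualSeq {k : ℤ} (h₁ : -(m : ℤ) - 1 ≤ k) (h₂ : k ≤ n + 1) :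
    (Module.finrank ℂ (rightSpace (dualSeq A) n m (-k)) : ℤ) =
      Module.finrank ℂ (rightSpace A m n k) + (n + 1 - k) * Fintype.card ι -
        (k + m + 1) * Fintype.card κ := by
  obtain ⟨r, hr⟩ := Int.eq_ofNat_of_zero_le (show 0 ≤ (n : ℤ) + 1 - k by omega)
  obtain ⟨c, hc⟩ := Int.eq_ofNat_of_zero_le (show 0 ≤ k + m + 1 by omega)
  have h := finrank_rightSpace_add_rank (A := A) hr.symm hc.symm
  have h' := finrank_rightSpace_add_rank (A := dualSeq A) (m := n) (n := m) (k := -k) (r := c)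
    (c := r) (by omega) (by omega)
  rw [sectionMatrix_dualSeq, Matrix.rank_transpose] at h'
  rw [hr, hc]
  zify at h h'
  linarith

lemma rightIncrement_dualSeq {k : ℤ} (h₁ : -(m : ℤ) ≤ k) (h₂ : k ≤ n + 1) :
    rightIncrement (dualSeq A) n m (1 - k) =
      Fintype.card ι + Fintype.card κ - rightIncrement A m n k := by
  rw [rightIncrement, rightIncrement, show 1 - k = -(k - 1) by ring,
    finrank_rightSpace_dualSeq (by omega) (by omega), show -(k - 1) - 1 = -k by ring,
    finrank_rightSpace_dualSeq (by omega) (by omega)]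
  ring

/-- The bound is the nonnegativity of an increment of the dual sequence. -/
lemma rightIncrement_le {k : ℤ} (hk : k ≤ n + 1) :
    rightIncrement A m n k ≤ Fintype.card ι + Fintype.card κ := by
  have h₁ := rightIncrement_mono (A := A) (m := m) hk le_rfl
  have h₂ := rightIncrement_dualSeq (A := A) (m := m) (n := n) (k := n + 1) (by omega) le_rfl
  have h₃ := rightIncrement_nonneg (A := dualSeq A) (m := n) (n := m) (1 - (n + 1))
  omega

/-- The tuple `μ` consists of the indices of the sequence, in any order. -/
structure IsIndexFamily (A : ℤ → Matrix ι κ ℂ) (m n : ℕ) (μ : Fin N → ℤ) : Prop where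
  le : ∀ j, -(m : ℤ) - 1 ≤ μ j
  ge : ∀ j, μ j ≤ n + 1
  count : ∀ k : ℤ, -(m : ℤ) - 1 ≤ k → k ≤ n + 1 →
    ((Finset.univ.filter fun j => μ j < k).card : ℤ) = rightIncrement A m n k

/-- As the increments grow, the `k` counted by `essentialIndex` form an initial segment. -/
lemma essentialIndex_lt_iff {k : ℤ} (h₁ : -(m : ℤ) ≤ k) (h₂ : k ≤ n + 1) (i : ℕ) :
    essentialIndex A m n i < k ↔ (i : ℤ) < rightIncrement A m n k := by
  rw [essentialIndex]
  constructor
  · intro h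
    by_contra! h'
    have : Finset.Icc (-(m : ℤ)) k ⊆
        (Finset.Icc (-(m : ℤ)) (n + 1)).filter fun k => rightIncrement A m n k ≤ i := by
      intro l hl
      simp only [Finset.mem_Icc, Finset.mem_filter] at hl ⊢
      exact ⟨by omega, (rightIncrement_mono hl.2 h₂).trans h'⟩
    have := Finset.card_le_card this
    rw [Int.card_Icc] at this
    omega
  · intro h
    have : ((Finset.Icc (-(m : ℤ)) (n + 1)).filter fun k => rightIncrement A m n k ≤ i) ⊆
        Finset.Icc (-(m : ℤ)) (k - 1) := by
      intro l hl
      simp only [Finset.mem_Icc, Finset.mem_filter] at hl ⊢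
      refine ⟨hl.1.1, ?_⟩
      by_contra! h'
      have := rightIncrement_mono (A := A) (m := m) (n := n) (show k ≤ l by omega) hl.1.2
      omega
    have := Finset.card_le_card this
    rw [Int.card_Icc] at this
    omega

lemma isIndexFamily_indices (hN : N = Fintype.card ι + Fintype.card κ) :
    IsIndexFamily A m n (indices A m n N) where
  le j := by
    rw [indices, essentialIndex]
    omega
  ge j := by
    have := Finset.card_filter_le (Finset.Icc (-(m : ℤ)) (n + 1))
      fun k => rightIncrement A m n k ≤ (j : ℕ)
    rw [Int.card_Icc] at this
    rw [indices, essentialIndex]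
    omega
  count k h₁ h₂ := by
    rcases eq_or_lt_of_le h₁ with h | h
    · rw [rightIncrement_of_lt (by omega), Nat.cast_eq_zero, Finset.card_eq_zero,
        Finset.filter_eq_empty_iff]
      intro j _
      rw [indices, essentialIndex]
      omega
    · obtain ⟨d, hd⟩ := Int.eq_ofNat_of_zero_le (rightIncrement_nonneg (A := A) (m := m) (n := n) k)
      have hle := rightIncrement_le (A := A) (m := m) (n := n) h₂
      have : (Finset.univ.filter fun j : Fin N => indices A m n N j < k) =
          Finset.univ.filter fun j : Fin N => (j : ℕ) < d := by
        ext j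
        simp only [Finset.mem_filter, Finset.mem_univ, true_and]
        rw [indices, essentialIndex_lt_iff (by omega) h₂, hd]
        omega
      rw [this, hd, Fin.card_filter_val_lt]
      omega

lemma IsIndexFamily.dual {μ : Fin N → ℤ} (hμ : IsIndexFamily A m n μ)
    (hN : N = Fintype.card ι + Fintype.card κ) : IsIndexFamily (dualSeq A) n m (-μ) where
  le j := by
    have := hμ.ge j
    simp only [Pi.neg_apply]
    omega
  ge j := by
    have := hμ.le j
    simp only [Pi.neg_apply]
    omega
  count k h₁ h₂ := by
    rcases eq_or_lt_of_le h₁ with h | h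
    · rw [rightIncrement_of_lt (by omega), Nat.cast_eq_zero, Finset.card_eq_zero,
        Finset.filter_eq_empty_iff]
      intro j _
      have := hμ.ge j
      simp only [Pi.neg_apply]
      omega
    · have h₃ := rightIncrement_dualSeq (A := A) (m := m) (n := n) (k := 1 - k)
        (by omega) (by omega)
      rw [← hμ.count _ (by omega) (by omega), sub_sub_cancel] at h₃
      have h₄ := Finset.card_filter_add_card_filter_not (s := Finset.univ) fun j => μ j < 1 - k
      have h₅ : (Finset.univ.filter fun j => (-μ) j < k) =
          Finset.univ.filter fun j => ¬ μ j < 1 - k := by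
        ext j
        simp only [Finset.mem_filter, Finset.mem_univ, true_and, Pi.neg_apply]
        omega
      rw [h₅, h₃]
      rw [Finset.card_univ, Fintype.card_fin] at h₄
      omega

/-- The dimensions of the spaces in terms of the indices. -/
lemma IsIndexFamily.finrank_rightSpace {μ : Fin N → ℤ} (hμ : IsIndexFamily A m n μ) {k : ℤ}
    (h₁ : -(m : ℤ) - 1 ≤ k) (h₂ : k ≤ n + 1) :
    (Module.finrank ℂ (rightSpace A m n k) : ℤ) = ∑ j, max 0 (k - μ j) := by
  induction k, h₁ using Int.leInduction with
  | base =>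
    rw [rightSpace_eq_bot (by omega), finrank_bot, Nat.cast_zero, eq_comm]
    refine Finset.sum_eq_zero fun j _ => ?_
    have := hμ.le j
    omega
  | succ k hk ih =>
    have h := hμ.count (k + 1) (by omega) h₂
    rw [rightIncrement, add_sub_cancel_right, ih (by omega), Finset.card_filter,
      Nat.cast_sum] at h
    rw [eq_comm, sub_eq_iff_eq_add, ← Finset.sum_add_distrib] at h
    rw [h]
    refine Finset.sum_congr rfl fun j _ => ?_
    split_ifs <;> omega

lemma IsIndexFamily.sum_eq {μ : Fin N → ℤ} (hμ : IsIndexFamily A m n μ)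
    (hN : N = Fintype.card ι + Fintype.card κ) :
    ∑ j, μ j = (n + 1) * Fintype.card ι - (m + 1) * Fintype.card κ := by
  have h₁ := hμ.finrank_rightSpace (k := n + 1) (by omega) le_rfl
  have h₂ := finrank_rightSpace_add_rank (A := A) (m := m) (n := n) (k := n + 1) (r := 0)
    (c := n + m + 2) (by simp) (by push_cast; ring)
  have h₃ : (sectionMatrix A (n + 1) 0 (n + m + 2)).rank = 0 := by
    have := Matrix.rank_le_card_height (sectionMatrix A (n + 1) 0 (n + m + 2))
    simpa using this
  have h₄ : ∑ j, max 0 ((n : ℤ) + 1 - μ j) = N * (n + 1) - ∑ j, μ j := by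
    rw [Finset.sum_congr rfl fun j _ => max_eq_right (sub_nonneg.mpr (hμ.ge j)),
      Finset.sum_sub_distrib]
    simp
  rw [h₃, add_zero] at h₂
  rw [h₄, h₂] at h₁
  subst hN
  push_cast at h₁
  linarith

/-- The multiplicity of the index `k` is the number of essential polynomials of that index. -/
lemma IsIndexFamily.card_fiber {μ : Fin N → ℤ} (hμ : IsIndexFamily A m n μ) {k : ℤ}
    (h₁ : -(m : ℤ) - 1 ≤ k) (h₂ : k ≤ n) :
    Fintype.card {j // μ j = k} +
      Module.finrank ℂ ↥(rightSpace A m n k ⊔ (rightSpace A m n k).map (shift κ 1)) =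
      Module.finrank ℂ (rightSpace A m n (k + 1)) := by
  have h₃ := finrank_sup_shift (A := A) (m := m) k h₂
  have h₄ := hμ.count k h₁ (by omega)
  have h₅ := hμ.count (k + 1) (by omega) (by omega)
  have h₆ : (Finset.univ.filter fun j => μ j < k + 1).card =
      (Finset.univ.filter fun j => μ j < k).card + (Finset.univ.filter fun j => μ j = k).card := by
    rw [← Finset.card_union_of_disjoint, ← Finset.filter_or]
    · congr 1
      ext j
      simp only [Finset.mem_filter, Finset.mem_univ, true_and]
      omega
    · rw [Finset.disjoint_filter]
      intro j _ h
      omega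
  rw [Fintype.card_subtype]
  rw [rightIncrement] at h₄ h₅
  rw [add_sub_cancel_right] at h₅
  omega

/-- The span of the columns of `A_{-m}, …, A_n`. -/
def columnSpan (A : ℤ → Matrix ι κ ℂ) (m n : ℕ) : Submodule ℂ (ι → ℂ) :=
  Submodule.span ℂ {v : ι → ℂ | ∃ k ∈ Finset.Icc (-(m : ℤ)) n, ∃ t, v = fun s => A k s t}

lemma finrank_columnSpan :
    Module.finrank ℂ (columnSpan A m n) = (sectionMatrix A n 1 (n + m + 1)).rank := by
  have h : sectionMatrix A n 1 (n + m + 1) =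
      (Matrix.of fun (s : ι) (y : Fin (n + m + 1) × κ) => A (n - y.1) s y.2).submatrix
        (Equiv.uniqueProd ι (Fin 1)) (Equiv.refl _) := by
    ext x y
    simp [sectionMatrix, Equiv.uniqueProd]
  have hcol : {v : ι → ℂ | ∃ k ∈ Finset.Icc (-(m : ℤ)) n, ∃ t, v = fun s => A k s t} =
      Set.range (Matrix.of fun (s : ι) (y : Fin (n + m + 1) × κ) => A (n - y.1) s y.2).col := by
    ext v
    constructor
    · rintro ⟨k, hk, t, rfl⟩
      rw [Finset.mem_Icc] at hk
      refine ⟨(⟨(n - k).toNat, by omega⟩, t), ?_⟩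
      funext s
      simp only [Matrix.col_apply, Matrix.of_apply]
      rw [show (n : ℤ) - ((n - k).toNat : ℕ) = k by omega]
    · rintro ⟨y, rfl⟩
      exact ⟨n - y.1, Finset.mem_Icc.mpr (by omega), y.2, rfl⟩
  rw [h, Matrix.rank_submatrix, Matrix.rank_eq_finrank_span_cols, columnSpan, hcol]

/-- The index `n + 1` occurs as often as the codimension of the column span. -/
lemma IsIndexFamily.card_top {μ : Fin N → ℤ} (hμ : IsIndexFamily A m n μ)
    (hN : N = Fintype.card ι + Fintype.card κ) :
    Fintype.card {j // μ j = n + 1} + Module.finrank ℂ (columnSpan A m n) = Fintype.card ι := by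
  have h₁ := hμ.count (n + 1) (by omega) le_rfl
  have h₂ := finrank_rightSpace_add_rank (A := A) (m := m) (n := n) (k := n + 1) (r := 0)
    (c := n + m + 2) (by simp) (by push_cast; ring)
  have h₃ : (sectionMatrix A (n + 1) 0 (n + m + 2)).rank = 0 := by
    have := Matrix.rank_le_card_height (sectionMatrix A (n + 1) 0 (n + m + 2))
    simpa using this
  have h₄ := finrank_rightSpace_add_rank (A := A) (m := m) (n := n) (k := n) (r := 1)
    (c := n + m + 1) (by simp) (by push_cast; ring)
  have h₅ := Finset.card_filter_add_card_filter_not (s := Finset.univ) fun j => μ j < n + 1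
  have h₆ : (Finset.univ.filter fun j => ¬ μ j < n + 1) =
      Finset.univ.filter fun j => μ j = n + 1 := by
    ext j
    have := hμ.ge j
    simp only [Finset.mem_filter, Finset.mem_univ, true_and]
    omega
  rw [h₆, Finset.card_univ, Fintype.card_fin] at h₅
  rw [Fintype.card_subtype, finrank_columnSpan]
  rw [rightIncrement, add_sub_cancel_right] at h₁
  have h₇ : (n + m + 2) * Fintype.card κ = (n + m + 1) * Fintype.card κ + Fintype.card κ := by ring
  omega

end Indices

section RightSystems

/-! ### Full right systems for an arbitrary enumeration of the indices -/

variable {ι κ : Type} [Fintype ι] [Fintype κ] [DecidableEq ι] [DecidableEq κ]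
  {A : ℤ → Matrix ι κ ℂ} {m n N : ℕ} {μ : Fin N → ℤ}

/-- A full right system whose columns are enumerated by the index family `μ`, in any order. -/
structure IsRightSystem (A : ℤ → Matrix ι κ ℂ) (m n : ℕ) (μ : Fin N → ℤ)
    (R : Matrix κ (Fin N) ℂ[T;T⁻¹]) (α : Matrix ι (Fin N) ℂ[T;T⁻¹]) : Prop where
  essential : ∀ k ∈ Finset.Icc (-(m : ℤ) - 1) n,
    IsComplementBasis (fun (j : {j : Fin N // μ j = k}) (t : κ) => R t j)
      (rightSpace A m n k ⊔ (rightSpace A m n k).map (shift κ 1)) (rightSpace A m n (k + 1))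
  poly : IsPolyInZInv α
  decomposition : ∃ β : Matrix ι (Fin N) ℂ[T;T⁻¹], IsPolyInZ β ∧
    genFun A m n * R = α * indexDiag μ - (LaurentPolynomial.T ((n : ℤ) + 1) : ℂ[T;T⁻¹]) • β
  complement_degree : ∀ j, μ j = n + 1 → ∀ t, SupportedIn (R t j) 0 (n + m + 2)
  complement_span :
    Submodule.span ℂ ({v : ι → ℂ | ∃ k ∈ Finset.Icc (-(m : ℤ)) n, ∃ t, v = fun s => A k s t} ∪
      {v : ι → ℂ | ∃ j, μ j = n + 1 ∧ v = fun s => (α s j).coeff 0}) = ⊤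

lemma isFullRightSystem_iff {R : Matrix κ (Fin N) ℂ[T;T⁻¹]} {α : Matrix ι (Fin N) ℂ[T;T⁻¹]} :
    IsFullRightSystem A m n R α ↔ IsRightSystem A m n (indices A m n N) R α :=
  ⟨fun h => ⟨h.1, h.2, h.3, h.4, h.5⟩, fun h => ⟨h.1, h.2, h.3, h.4, h.5⟩⟩

lemma exists_isComplementBasis {V τ : Type} [AddCommGroup V] [Module ℂ V] [Fintype τ]
    {S W : Submodule ℂ V} [FiniteDimensional ℂ W] (hSW : S ≤ W)
    (h : Fintype.card τ + Module.finrank ℂ S = Module.finrank ℂ W) :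
    ∃ v : τ → V, IsComplementBasis v S W := by
  obtain ⟨D, hD⟩ := S.exists_isCompl
  let C : Submodule ℂ V := D ⊓ W
  have hdisj : Disjoint S C := hD.disjoint.mono_right inf_le_left
  have hsup : S ⊔ C = W := by
    rw [← sup_inf_assoc_of_le D hSW, hD.sup_eq_top, top_inf_eq]
  have : FiniteDimensional ℂ S := Submodule.finiteDimensional_of_le hSW
  have : FiniteDimensional ℂ C := Submodule.finiteDimensional_of_le (inf_le_right : C ≤ W)
  have hdim := Submodule.finrank_sup_add_finrank_inf_eq S C
  rw [hsup, hdisj.eq_bot, finrank_bot] at hdim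
  let b := (Module.finBasis ℂ C).reindex
    (Fintype.equivOfCardEq (show Fintype.card (Fin (Module.finrank ℂ C)) = Fintype.card τ by
      rw [Fintype.card_fin]; omega))
  have hspan : Submodule.span ℂ (Set.range fun t => (b t : V)) = C := by
    have := congrArg (Submodule.map C.subtype) b.span_eq
    rwa [Submodule.map_span, ← Set.range_comp, Submodule.map_top, Submodule.range_subtype] at this
  refine ⟨fun t => b t, ⟨b.linearIndependent.map' C.subtype (Submodule.ker_subtype C), ?_, ?_⟩⟩
  · rwa [hspan]
  · rw [hspan, hsup]

lemma IsComplementBasis.mem {V τ : Type} [AddCommGroup V] [Module ℂ V] {v : τ → V}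
    {S W : Submodule ℂ V} (h : IsComplementBasis v S W) (t : τ) : v t ∈ W := by
  rw [← h.sup_eq]
  exact Submodule.mem_sup_right (Submodule.subset_span ⟨t, rfl⟩)

lemma mul_apply_eq_mulVec (F : Matrix ι κ ℂ[T;T⁻¹]) (R : Matrix κ (Fin N) ℂ[T;T⁻¹]) (s : ι)
    (j : Fin N) : (F * R) s j = F.mulVec (fun t => R t j) s := rfl

theorem exists_isRightSystem (hμ : IsIndexFamily A m n μ)
    (hN : N = Fintype.card ι + Fintype.card κ) : ∃ R α, IsRightSystem A m n μ R α := by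
  have hex : ∀ k : ℤ, ∃ v : {j : Fin N // μ j = k} → (κ → ℂ[T;T⁻¹]),
      k ∈ Finset.Icc (-(m : ℤ) - 1) n → IsComplementBasis v
        (rightSpace A m n k ⊔ (rightSpace A m n k).map (shift κ 1)) (rightSpace A m n (k + 1)) := by
    intro k
    by_cases hk : k ∈ Finset.Icc (-(m : ℤ) - 1) n
    · have hk' := Finset.mem_Icc.mp hk
      obtain ⟨v, hv⟩ := exists_isComplementBasis (sup_shift_le k) (hμ.card_fiber hk'.1 hk'.2)
      exact ⟨v, fun _ => hv⟩
    · exact ⟨fun _ => 0, fun h => absurd h hk⟩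
  choose v hv using hex
  obtain ⟨w, hw⟩ := exists_isComplementBasis (le_top : columnSpan A m n ≤ ⊤)
    (τ := {j // μ j = n + 1}) (by rw [hμ.card_top hN, finrank_top, Module.finrank_pi])
  -- The columns of index `n + 1` are zero, with constant columns of `α` and `β` that cancel.
  let R : Matrix κ (Fin N) ℂ[T;T⁻¹] := Matrix.of fun t j =>
    if μ j = n + 1 then 0 else v (μ j) ⟨j, rfl⟩ t
  let f := genFun A m n * R
  let α : Matrix ι (Fin N) ℂ[T;T⁻¹] := Matrix.of fun s j =>
    if h : μ j = n + 1 then LaurentPolynomial.C (w ⟨j, h⟩ s)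
    else LaurentPolynomial.T (-μ j) * truncLT (n + 1) (f s j)
  let β : Matrix ι (Fin N) ℂ[T;T⁻¹] := Matrix.of fun s j =>
    if h : μ j = n + 1 then LaurentPolynomial.C (w ⟨j, h⟩ s)
    else LaurentPolynomial.T (-((n : ℤ) + 1)) * -(f s j - truncLT (n + 1) (f s j))
  have hess : ∀ k ∈ Finset.Icc (-(m : ℤ) - 1) n,
    IsComplementBasis (fun (j : {j : Fin N // μ j = k}) (t : κ) => R t j)
      (rightSpace A m n k ⊔ (rightSpace A m n k).map (shift κ 1)) (rightSpace A m n (k + 1)) := by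
    intro k hk
    have : (fun (j : {j : Fin N // μ j = k}) (t : κ) => R t j) = v k := by
      funext ⟨j, hj⟩ t
      subst hj
      have := (Finset.mem_Icc.mp hk).2
      simp only [R, Matrix.of_apply]
      rw [if_neg (by omega)]
    rw [this]
    exact hv k hk
  refine ⟨R, α, hess, ?_, ⟨β, ?_, ?_⟩, ?_, ?_⟩
  · rw [isPolyInZInv_iff]
    intro s j
    by_cases h : μ j = n + 1
    · simp only [α, Matrix.of_apply, dif_pos h]
      exact DegLE.C _
    · have h₁ := hμ.le j
      have h₂ := hμ.ge j
      have hmem := (hess (μ j) (Finset.mem_Icc.mpr (by omega))).mem ⟨j, rfl⟩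
      rw [mem_rightSpace] at hmem
      have hdeg : DegLE (μ j) (truncLT (n + 1) (f s j)) := by
        intro k hk
        rw [coeff_truncLT]
        split_ifs with hk'
        · exact hmem.2 k (by omega) (by omega) s
        · rfl
      simp only [α, Matrix.of_apply, dif_neg h]
      exact (hdeg.T_mul _).mono (by omega)
  · rw [isPolyInZ_iff]
    intro s j
    by_cases h : μ j = n + 1
    · simp only [β, Matrix.of_apply, dif_pos h]
      exact OrderGE.C _
    · simp only [β, Matrix.of_apply, dif_neg h]
      exact ((orderGE_sub_truncLT _ _).neg.T_mul _).mono (by omega)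
  · ext1 s j
    rw [Matrix.sub_apply, Matrix.smul_apply, indexDiag, Matrix.mul_diagonal, smul_eq_mul]
    by_cases h : μ j = n + 1
    · have : f s j = 0 := by
        refine Finset.sum_eq_zero fun t _ => ?_
        simp [R, h]
      change f s j = _
      rw [this]
      simp only [α, β, Matrix.of_apply, dif_pos h]
      rw [h]
      ring
    · simp only [α, β, Matrix.of_apply, dif_neg h]
      change f s j = _
      have h₁ : LaurentPolynomial.T (-μ j) * LaurentPolynomial.T (μ j) = (1 : ℂ[T;T⁻¹]) := by
        rw [← LaurentPolynomial.T_add, neg_add_cancel, LaurentPolynomial.T_zero]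
      have h₂ : LaurentPolynomial.T ((n : ℤ) + 1) * LaurentPolynomial.T (-((n : ℤ) + 1)) =
          (1 : ℂ[T;T⁻¹]) := by
        rw [← LaurentPolynomial.T_add, add_neg_cancel, LaurentPolynomial.T_zero]
      rw [mul_right_comm, h₁, ← mul_assoc, h₂]
      ring
  · intro j hj t
    simp only [R, Matrix.of_apply, if_pos hj]
    exact supportedIn_iff.mpr ⟨OrderGE.zero, DegLE.zero⟩
  · rw [eq_top_iff, ← hw.sup_eq, columnSpan, ← Submodule.span_union]
    refine Submodule.span_mono (Set.union_subset_union_right _ ?_)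
    rintro _ ⟨⟨j, hj⟩, rfl⟩
    refine ⟨j, hj, ?_⟩
    funext s
    simp [α, hj]

namespace IsRightSystem

variable {R : Matrix κ (Fin N) ℂ[T;T⁻¹]} {α : Matrix ι (Fin N) ℂ[T;T⁻¹]}

lemma col_mem (h : IsRightSystem A m n μ R α) (hμ : IsIndexFamily A m n μ) {j : Fin N}
    (hj : μ j ≤ n) : (fun t => R t j) ∈ rightSpace A m n (μ j + 1) :=
  (h.essential (μ j) (Finset.mem_Icc.mpr ⟨hμ.le j, hj⟩)).mem ⟨j, rfl⟩

lemma orderGE (h : IsRightSystem A m n μ R α) (hμ : IsIndexFamily A m n μ) (t : κ) (j : Fin N) :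
    OrderGE 0 (R t j) := by
  by_cases hj : μ j ≤ n
  · exact (mem_rightSpace.mp (h.col_mem hμ hj)).1.1 t
  · exact (supportedIn_iff.mp (h.complement_degree j (by have := hμ.ge j; omega) t)).1

lemma degLE (h : IsRightSystem A m n μ R α) (hμ : IsIndexFamily A m n μ) (t : κ) (j : Fin N) :
    DegLE (μ j + m + 1) (R t j) := by
  by_cases hj : μ j ≤ n
  · exact ((mem_rightSpace.mp (h.col_mem hμ hj)).1.2 t).mono (by omega)
  · exact (supportedIn_iff.mp (h.complement_degree j (by have := hμ.ge j; omega) t)).2.mono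
      (by omega)

/-- For an index at most `n`, the constant term of `α₋` is a coefficient of `A(z) R(z)`. -/
lemma coeff_alpha (h : IsRightSystem A m n μ R α) {j : Fin N} (hj : μ j ≤ n) (s : ι) :
    (α s j).coeff 0 = ((genFun A m n).mulVec (fun t => R t j) s).coeff (μ j) := by
  obtain ⟨β, hβ, hdec⟩ := h.decomposition
  have := congrFun (congrFun hdec s) j
  rw [Matrix.sub_apply, Matrix.smul_apply, indexDiag, Matrix.mul_diagonal, smul_eq_mul] at this
  rw [← mul_apply_eq_mulVec, this, coeff_sub', coeff_mul_T, coeff_T_mul,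
    isPolyInZ_iff.mp hβ s j _ (by omega), sub_self, sub_zero]

lemma coeff_mulVec_mem_columnSpan (r : κ → ℂ[T;T⁻¹]) (k : ℤ) :
    (fun s => ((genFun A m n).mulVec r s).coeff k) ∈ columnSpan A m n := by
  have : (fun s => ((genFun A m n).mulVec r s).coeff k) =
      ∑ t, ∑ l ∈ Finset.Icc (-(m : ℤ)) n, (r t).coeff (k - l) • fun s => A l s t := by
    funext s
    simp only [Matrix.mulVec, dotProduct, coeff_finset_sum, coeff_genFun_mul, Finset.sum_apply,
      Pi.smul_apply, smul_eq_mul]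
    exact Finset.sum_congr rfl fun t _ => Finset.sum_congr rfl fun l _ => mul_comm _ _
  rw [this]
  exact Submodule.sum_mem _ fun t _ => Submodule.sum_mem _ fun l hl =>
    Submodule.smul_mem _ _ (Submodule.subset_span ⟨l, hl, t, rfl⟩)

/-- The constant terms of `α₋` in the columns of index `n + 1` are linearly independent modulo the
column span of the sequence, because their number is its codimension. -/
lemma linearIndependent_top (h : IsRightSystem A m n μ R α) (hμ : IsIndexFamily A m n μ)
    (hN : N = Fintype.card ι + Fintype.card κ) :
    LinearIndependent ℂ fun j : {j // μ j = n + 1} =>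
      (columnSpan A m n).mkQ fun s => (α s j).coeff 0 := by
  apply linearIndependent_of_top_le_span_of_card_eq_finrank
  · have h₁ := congrArg (Submodule.map (columnSpan A m n).mkQ) h.complement_span
    rw [Submodule.map_top, Submodule.range_mkQ, Submodule.span_union, Submodule.map_sup,
      ← columnSpan, Submodule.mkQ_map_self, bot_sup_eq, Submodule.map_span] at h₁
    rw [← h₁]
    refine Submodule.span_mono ?_
    rintro _ ⟨_, ⟨j, hj, rfl⟩, rfl⟩
    exact ⟨⟨j, hj⟩, rfl⟩
  · have h₁ := Submodule.finrank_quotient_add_finrank (columnSpan A m n)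
    have h₂ := hμ.card_top hN
    rw [Module.finrank_pi] at h₁
    omega

/-- The leading coefficients of a full right system, which make up the value at infinity of
`U₋(z)`, are linearly independent. -/
lemma eq_zero_of_leading_eq_zero (h : IsRightSystem A m n μ R α) (hμ : IsIndexFamily A m n μ)
    (hN : N = Fintype.card ι + Fintype.card κ) {c : Fin N → ℂ}
    (hR : ∀ t, ∑ j, (R t j).coeff (μ j + m + 1) * c j = 0)
    (hα : ∀ s, ∑ j, (α s j).coeff 0 * c j = 0) : c = 0 := by
  by_contra hc
  obtain ⟨i, hi⟩ : ∃ i, c i ≠ 0 := by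
    by_contra! h'
    exact hc (funext h')
  obtain ⟨j₀, hj₀, hmax⟩ := Finset.exists_max_image (Finset.univ.filter fun j => c j ≠ 0) μ
    ⟨i, by simpa using hi⟩
  simp only [Finset.mem_filter, Finset.mem_univ, true_and] at hj₀ hmax
  -- The largest index with a nonzero coefficient is either `n + 1`, where the complementation
  -- condition applies, or at most `n`, where essentiality does.
  by_cases htop : μ j₀ = n + 1
  · have hsum : ∑ j, c j • (columnSpan A m n).mkQ (fun s => (α s j).coeff 0) = 0 := by
      simp only [← map_smul, ← map_sum]
      rw [show (∑ j, c j • fun s => (α s j).coeff 0) = 0 from ?_, map_zero]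
      funext s
      simpa [Finset.sum_apply, mul_comm] using hα s
    rw [← Fintype.sum_subtype_add_sum_subtype (fun j => μ j = n + 1), add_eq_left.mpr] at hsum
    · exact hj₀ (Fintype.linearIndependent_iff.mp (h.linearIndependent_top hμ hN)
        (fun j => c j) hsum ⟨j₀, htop⟩)
    · refine Finset.sum_eq_zero fun j _ => ?_
      have hj : μ j ≤ n := by have := hμ.ge j; have := j.2; omega
      rw [Submodule.mkQ_apply, (Submodule.Quotient.mk_eq_zero _).mpr ?_, smul_zero]
      simp only [h.coeff_alpha hj]
      exact coeff_mulVec_mem_columnSpan _ _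
  · set k := μ j₀ with hk
    have hkn : k ≤ n := by have := hμ.ge j₀; omega
    -- The combination of the columns, shifted to the common index `k`.
    let y : Fin N → κ → ℂ[T;T⁻¹] := fun j => c j • shift κ (k - μ j) fun t => R t j
    have hy₀ : ∀ j, c j = 0 → y j = 0 := fun j hj => by simp [y, hj]
    have hy₁ : ∀ j, y j ∈ rightSpace A m n (k + 1) := by
      intro j
      by_cases hj : c j = 0
      · rw [hy₀ j hj]
        exact Submodule.zero_mem _
      · have hjk := hmax j hj
        have := shift_mem_rightSpace (show 0 ≤ k - μ j by omega) (h.col_mem hμ (j := j) (by omega))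
        rw [show μ j + 1 + (k - μ j) = k + 1 by ring] at this
        exact Submodule.smul_mem _ _ this
    have hy₂ : ∀ j, μ j ≠ k → y j ∈ (rightSpace A m n k).map (shift κ 1) := by
      intro j hjk
      by_cases hj : c j = 0
      · rw [hy₀ j hj]
        exact Submodule.zero_mem _
      · have hjk' := hmax j hj
        have := shift_mem_rightSpace (show 0 ≤ k - μ j - 1 by omega)
          (h.col_mem hμ (j := j) (by omega))
        rw [show μ j + 1 + (k - μ j - 1) = k by ring] at this
        refine Submodule.smul_mem _ _ ⟨_, this, ?_⟩
        funext t
        rw [shift_apply, shift_apply, shift_apply, ← mul_assoc, ← LaurentPolynomial.T_add,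
          add_sub_cancel]
    -- The vanishing leading coefficients put the combination into the smaller space `N_k`.
    have hr : ∑ j, y j ∈ rightSpace A m n k := by
      have hmem : ∑ j, y j ∈ rightSpace A m n (k + 1) := Submodule.sum_mem _ fun j _ => hy₁ j
      rw [mem_rightSpace] at hmem ⊢
      refine ⟨⟨hmem.1.1, fun t l hl => ?_⟩, fun l h₁ h₂ s => ?_⟩
      · by_cases hl' : l = k + 1 + m
        · rw [Finset.sum_apply, coeff_finset_sum, ← hR t]
          refine Finset.sum_congr rfl fun j _ => ?_
          simp only [y, Pi.smul_apply, AddMonoidAlgebra.coeff_smul, Finsupp.smul_apply,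
            shift_apply, coeff_T_mul, smul_eq_mul]
          rw [mul_comm, hl', show k + 1 + (m : ℤ) - (k - μ j) = μ j + m + 1 by ring]
        · exact hmem.1.2 t l (by omega)
      · by_cases hl : l = k
        · rw [Matrix.mulVec_sum, Finset.sum_apply, coeff_finset_sum, ← hα s]
          refine Finset.sum_congr rfl fun j _ => ?_
          by_cases hj : c j = 0
          · rw [hy₀ j hj, hj, Matrix.mulVec_zero, mul_zero]
            rfl
          · have hjk := hmax j hj
            simp only [y]
            rw [Matrix.mulVec_smul, Pi.smul_apply, AddMonoidAlgebra.coeff_smul, Finsupp.smul_apply,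
              coeff_mulVec_shift, h.coeff_alpha (by omega), hl, sub_sub_cancel, smul_eq_mul,
              mul_comm]
        · exact hmem.2 l (by omega) h₂ s
    have hbasis := h.essential k (Finset.mem_Icc.mpr ⟨hμ.le j₀, hkn⟩)
    have hsplit := Fintype.sum_subtype_add_sum_subtype (fun j => μ j = k) y
    have hyk : ∀ j : {j // μ j = k}, y j = c j • fun t => R t j := by
      rintro ⟨j, hj⟩
      simp only [y, hj, sub_self]
      congr 1
      funext t
      rw [shift_apply, LaurentPolynomial.T_zero, one_mul]
    have hmem₁ : ∑ j : {j // μ j = k}, y j ∈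
        rightSpace A m n k ⊔ (rightSpace A m n k).map (shift κ 1) := by
      rw [eq_sub_of_add_eq hsplit]
      exact Submodule.sub_mem _ (Submodule.mem_sup_left hr)
        (Submodule.mem_sup_right (Submodule.sum_mem _ fun j _ => hy₂ j j.2))
    have hmem₂ : ∑ j : {j // μ j = k}, y j ∈ Submodule.span ℂ
        (Set.range fun (j : {j : Fin N // μ j = k}) (t : κ) => R t j) :=
      Submodule.sum_mem _ fun j _ => by
        rw [hyk]
        exact Submodule.smul_mem _ _ (Submodule.subset_span ⟨j, rfl⟩)
    have hzero := Submodule.disjoint_def.mp hbasis.disjoint _ hmem₁ hmem₂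
    simp only [hyk] at hzero
    exact hj₀ (Fintype.linearIndependent_iff.mp hbasis.linearIndependent (fun j => c j) hzero
      ⟨j₀, rfl⟩)

end IsRightSystem

end RightSystems

section Factorization

/-! ### Unimodularity and the Wiener–Hopf factorization -/

variable {ι κ : Type} [Fintype ι] [Fintype κ] [DecidableEq ι] [DecidableEq κ]
  {A : ℤ → Matrix ι κ ℂ} {m n N : ℕ} {μ : Fin N → ℤ}

/-- The matrix `U₋(z)` for an arbitrary enumeration `μ` of the indices. -/
def rightFactor (m : ℕ) (μ : Fin N → ℤ) (R : Matrix κ (Fin N) ℂ[T;T⁻¹])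
    (α : Matrix ι (Fin N) ℂ[T;T⁻¹]) : Matrix (κ ⊕ ι) (Fin N) ℂ[T;T⁻¹] :=
  Matrix.fromRows ((LaurentPolynomial.T (-(m : ℤ) - 1) : ℂ[T;T⁻¹]) • (R * indexDiagInv μ)) α

lemma rightFactor_inl (R : Matrix κ (Fin N) ℂ[T;T⁻¹]) (α : Matrix ι (Fin N) ℂ[T;T⁻¹]) (t : κ)
    (j : Fin N) : rightFactor m μ R α (Sum.inl t) j =
      LaurentPolynomial.T (-(m : ℤ) - 1) * (LaurentPolynomial.T (-μ j) * R t j) := by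
  rw [rightFactor, Matrix.fromRows_apply_inl, Matrix.smul_apply, indexDiagInv,
    Matrix.mul_diagonal, smul_eq_mul, mul_comm (R t j)]

/-- The symbol `G(z)`, with diagonal blocks `z^{-m-1}` and `z^{n+1}` and lower left block `A(z)`.
Its Wiener–Hopf factorization `G = U₋ d U₊` carries the inversion formulas. -/
def symbol (A : ℤ → Matrix ι κ ℂ) (m n : ℕ) : Matrix (κ ⊕ ι) (κ ⊕ ι) ℂ[T;T⁻¹] :=
  Matrix.fromBlocks ((LaurentPolynomial.T (-(m : ℤ) - 1) : ℂ[T;T⁻¹]) • 1) 0 (genFun A m n)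
    ((LaurentPolynomial.T ((n : ℤ) + 1) : ℂ[T;T⁻¹]) • 1)

lemma det_symbol : (symbol A m n).det = LaurentPolynomial.T
    (((n : ℤ) + 1) * Fintype.card ι - ((m : ℤ) + 1) * Fintype.card κ) := by
  rw [symbol, Matrix.det_fromBlocks_zero₁₂, Matrix.det_smul, Matrix.det_smul, Matrix.det_one,
    Matrix.det_one, mul_one, mul_one, LaurentPolynomial.T_pow, LaurentPolynomial.T_pow,
    ← LaurentPolynomial.T_add]
  congr 1
  ring

lemma prod_T {τ : Type} (S : Finset τ) (f : τ → ℤ) :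
    ∏ j ∈ S, (LaurentPolynomial.T (f j) : ℂ[T;T⁻¹]) = LaurentPolynomial.T (∑ j ∈ S, f j) := by
  classical
  induction S using Finset.induction_on with
  | empty => simp
  | insert a S ha ih =>
    rw [Finset.prod_insert ha, Finset.sum_insert ha, ih, LaurentPolynomial.T_add]

lemma det_indexDiag (μ : Fin N → ℤ) :
    (indexDiag μ).det = LaurentPolynomial.T (∑ j, μ j) := by
  rw [indexDiag, Matrix.det_diagonal, prod_T]

lemma indexDiagInv_mul_indexDiag (μ : Fin N → ℤ) : indexDiagInv μ * indexDiag μ = 1 := by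
  rw [indexDiagInv, indexDiag, Matrix.diagonal_mul_diagonal, ← Matrix.diagonal_one]
  congr 1
  funext j
  rw [← LaurentPolynomial.T_add, neg_add_cancel, LaurentPolynomial.T_zero]

/-- The decomposition of `A(z) R(z)` is the relation `G (R; β₊) = U₋ d`. -/
lemma symbol_mul_fromRows {R : Matrix κ (Fin N) ℂ[T;T⁻¹]} {α β : Matrix ι (Fin N) ℂ[T;T⁻¹]}
    (h : genFun A m n * R = α * indexDiag μ -
      (LaurentPolynomial.T ((n : ℤ) + 1) : ℂ[T;T⁻¹]) • β) :
    symbol A m n * Matrix.fromRows R β = rightFactor m μ R α * indexDiag μ := by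
  rw [symbol, rightFactor, Matrix.fromBlocks_mul_fromRows, Matrix.fromRows_mul, h, Matrix.zero_mul,
    add_zero, Matrix.smul_mul, Matrix.smul_mul, Matrix.one_mul, Matrix.one_mul, Matrix.smul_mul,
    Matrix.mul_assoc, indexDiagInv_mul_indexDiag, Matrix.mul_one, sub_add_cancel]

/-- A square matrix over a subring whose determinant is an invertible constant of the subring has
an inverse over the subring. -/
lemma exists_inverse_of_det_eq_C {σ : Type} [Fintype σ] [DecidableEq σ] (S : Subring ℂ[T;T⁻¹])
    (hS : ∀ c : ℂ, LaurentPolynomial.C c ∈ S) {M : Matrix σ (Fin N) ℂ[T;T⁻¹]}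
    (hM : ∀ i j, M i j ∈ S) (e : σ ≃ Fin N) {c : ℂ} (hc : c ≠ 0)
    (hdet : (M.submatrix id e).det = LaurentPolynomial.C c) :
    ∃ V : Matrix (Fin N) σ ℂ[T;T⁻¹], (∀ i j, V i j ∈ S) ∧ M * V = 1 ∧ V * M = 1 := by
  have hcc : LaurentPolynomial.C c⁻¹ * LaurentPolynomial.C c = 1 := by
    rw [← map_mul, inv_mul_cancel₀ hc, map_one]
  let V' := LaurentPolynomial.C c⁻¹ • (M.submatrix id e).adjugate
  have h₁ : M.submatrix id e * V' = 1 := by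
    rw [Matrix.mul_smul, Matrix.mul_adjugate, hdet, smul_smul, hcc, one_smul]
  have h₂ : V' * M.submatrix id e = 1 := by
    rw [Matrix.smul_mul, Matrix.adjugate_mul, hdet, smul_smul, hcc, one_smul]
  have hM' : M = (M.submatrix id e).submatrix id e.symm := by
    ext i j
    simp
  refine ⟨V'.submatrix e.symm id, fun i j => S.mul_mem (hS _)
    (adjugate_mem_of_forall_mem S (fun i j => hM i (e j)) _ _), ?_, ?_⟩
  · nth_rw 1 [hM']
    rw [Matrix.submatrix_mul_equiv, h₁, Matrix.submatrix_id_id]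
  · nth_rw 1 [hM']
    rw [← Matrix.submatrix_mul _ _ _ id _ Function.bijective_id, h₂, Matrix.submatrix_one_equiv]

namespace IsRightSystem

variable {R : Matrix κ (Fin N) ℂ[T;T⁻¹]} {α : Matrix ι (Fin N) ℂ[T;T⁻¹]}

lemma isPolyInZInv_rightFactor (h : IsRightSystem A m n μ R α) (hμ : IsIndexFamily A m n μ) :
    IsPolyInZInv (rightFactor m μ R α) := by
  rw [isPolyInZInv_iff]
  rintro (t | s) j
  · rw [rightFactor_inl]
    exact (((h.degLE hμ t j).T_mul _).T_mul _).mono (by omega)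
  · exact isPolyInZInv_iff.mp h.poly s j

/-- `U₋(z)` and `(R(z); β₊(z))` are unimodular.  They have the same determinant, by the sum of the
indices; it is a polynomial both in `z` and in `z⁻¹`, hence constant, and it does not vanish since
`U₋(∞)` is invertible. -/
lemma exists_inverses (h : IsRightSystem A m n μ R α) (hμ : IsIndexFamily A m n μ)
    (hN : N = Fintype.card ι + Fintype.card κ) :
    (∃ V : Matrix (Fin N) (κ ⊕ ι) ℂ[T;T⁻¹], IsPolyInZInv V ∧
      rightFactor m μ R α * V = 1 ∧ V * rightFactor m μ R α = 1) ∧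
    ∃ (W : Matrix (κ ⊕ ι) (Fin N) ℂ[T;T⁻¹]) (V : Matrix (Fin N) (κ ⊕ ι) ℂ[T;T⁻¹]),
      IsPolyInZ W ∧ IsPolyInZ V ∧ W * V = 1 ∧ V * W = 1 ∧ W.toRows₁ = R ∧
      symbol A m n * W = rightFactor m μ R α * indexDiag μ := by
  obtain ⟨β, hβ, hdec⟩ := h.decomposition
  have hUpoly := isPolyInZInv_iff.mp (h.isPolyInZInv_rightFactor hμ)
  set U := rightFactor m μ R α with hU
  set W := Matrix.fromRows R β with hW
  have hGW : symbol A m n * W = U * indexDiag μ := symbol_mul_fromRows hdec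
  have hWpoly : ∀ i j, OrderGE 0 (W i j) := by
    rintro (t | s) j
    · exact h.orderGE hμ t j
    · exact isPolyInZ_iff.mp hβ s j
  let e : κ ⊕ ι ≃ Fin N := Fintype.equivOfCardEq (by
    rw [Fintype.card_sum, Fintype.card_fin, hN, add_comm])
  -- Both sides of `G W = U₋ d` have determinants with the same power of `z`, which cancels.
  have hdet : (W.submatrix id e).det = (U.submatrix id e).det := by
    have h₁ : symbol A m n * W.submatrix id e =
        U.submatrix id e * (indexDiag μ).submatrix e e := by
      rw [Matrix.submatrix_mul_equiv, ← hGW]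
      exact (Matrix.submatrix_mul (symbol A m n) W id id e Function.bijective_id).symm
    have h₂ := congrArg Matrix.det h₁
    rw [Matrix.det_mul, Matrix.det_mul, det_symbol, Matrix.det_submatrix_equiv_self,
      det_indexDiag, hμ.sum_eq hN, mul_comm] at h₂
    exact (LaurentPolynomial.isUnit_T _).mul_right_cancel h₂
  have hge : OrderGE 0 (W.submatrix id e).det :=
    det_mem_of_forall_mem polySubring fun i j => hWpoly i (e j)
  have hle : DegLE 0 (U.submatrix id e).det :=
    det_mem_of_forall_mem polyInvSubring fun i j => hUpoly i (e j)
  have hUC := eq_C_of_orderGE_of_degLE (hdet ▸ hge) hle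
  have hne : (U.submatrix id e).det.coeff 0 ≠ 0 := by
    rw [coeff_zero_det (M := U.submatrix id e) fun i j => hUpoly i (e j)]
    intro h₀
    obtain ⟨v, hv, hv₀⟩ := Matrix.exists_mulVec_eq_zero_iff.mpr h₀
    have hsum : ∀ i, ∑ j, (U i j).coeff 0 * v (e.symm j) = 0 := by
      intro i
      refine Eq.trans ?_ (congrFun hv₀ i)
      rw [← e.sum_comp]
      simp [Matrix.mulVec, dotProduct]
    have hzero := h.eq_zero_of_leading_eq_zero hμ hN (c := fun j => v (e.symm j))
      (fun t => by
        rw [← hsum (Sum.inl t)]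
        refine Finset.sum_congr rfl fun j _ => ?_
        rw [hU, rightFactor_inl, coeff_T_mul, coeff_T_mul]
        congr 2
        ring)
      (fun s => hsum (Sum.inr s))
    exact hv (funext fun i => by simpa using congrFun hzero (e i))
  refine ⟨?_, ?_⟩
  · obtain ⟨V, hV, h₁, h₂⟩ := exists_inverse_of_det_eq_C polyInvSubring DegLE.C hUpoly e hne hUC
    exact ⟨V, isPolyInZInv_iff.mpr hV, h₁, h₂⟩
  · obtain ⟨V, hV, h₁, h₂⟩ := exists_inverse_of_det_eq_C polySubring OrderGE.C hWpoly e hne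
      (hdet.trans hUC)
    exact ⟨W, V, isPolyInZ_iff.mpr hWpoly, isPolyInZ_iff.mpr hV, h₁, h₂,
      Matrix.toRows₁_fromRows _ _, hGW⟩

end IsRightSystem

/-- `R` and `L` come from a Wiener–Hopf factorization `G = U₋ d U₊` of the symbol: `R` is the upper
block row of `U₊⁻¹` and `L` the right block column of `U₋⁻¹`. -/
def ComeFromFactorization (A : ℤ → Matrix ι κ ℂ) (m n : ℕ) (μ : Fin N → ℤ)
    (R : Matrix κ (Fin N) ℂ[T;T⁻¹]) (L : Matrix (Fin N) ι ℂ[T;T⁻¹]) : Prop :=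
  ∃ (U : Matrix (κ ⊕ ι) (Fin N) ℂ[T;T⁻¹]) (V : Matrix (Fin N) (κ ⊕ ι) ℂ[T;T⁻¹])
    (W : Matrix (κ ⊕ ι) (Fin N) ℂ[T;T⁻¹]) (Y : Matrix (Fin N) (κ ⊕ ι) ℂ[T;T⁻¹]),
    IsPolyInZInv U ∧ IsPolyInZInv V ∧ V * U = 1 ∧ IsPolyInZ W ∧ IsPolyInZ Y ∧ W * Y = 1 ∧
      symbol A m n * W = U * indexDiag μ ∧ W.toRows₁ = R ∧ V.toCols₂ = L

lemma IsRightSystem.comeFromFactorization {R : Matrix κ (Fin N) ℂ[T;T⁻¹]}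
    {α : Matrix ι (Fin N) ℂ[T;T⁻¹]} (h : IsRightSystem A m n μ R α)
    (hμ : IsIndexFamily A m n μ) (hN : N = Fintype.card ι + Fintype.card κ)
    {V : Matrix (Fin N) (κ ⊕ ι) ℂ[T;T⁻¹]} (hV : IsPolyInZInv V)
    (hVU : V * rightFactor m μ R α = 1) : ComeFromFactorization A m n μ R V.toCols₂ := by
  obtain ⟨-, W, Y, hW, hY, hWY, -, hR, hGW⟩ := h.exists_inverses hμ hN
  exact ⟨rightFactor m μ R α, V, W, Y, h.isPolyInZInv_rightFactor hμ, hV, hVU, hW, hY, hWY, hGW,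
    hR, rfl⟩

/-! ### Block Toeplitz matrices as truncated multiplications -/

lemma toeplitz_mulVec {a : ℤ → Matrix ι κ ℂ} {F : Matrix ι κ ℂ[T;T⁻¹]}
    (h : ∀ k : ℤ, -(m : ℤ) ≤ k → k ≤ n → ∀ s t, a k s t = (F s t).coeff k)
    (x : Fin (m + 1) × κ → ℂ) :
    (toeplitz m n a).mulVec x = coeffVec (n + 1) (F.mulVec (polyOfCoeffs κ (m + 1) x)) := by
  funext ⟨i, s⟩
  rw [coeffVec, coeff_mulVec_polyOfCoeffs]
  refine Finset.sum_congr rfl fun y _ => ?_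
  simp only [toeplitz, Matrix.of_apply]
  rw [h _ (by omega) (by omega)]

lemma toeplitz_mulVec_genFun (x : Fin (m + 1) × κ → ℂ) : (toeplitz m n A).mulVec x =
    coeffVec (n + 1) ((genFun A m n).mulVec (polyOfCoeffs κ (m + 1) x)) :=
  toeplitz_mulVec (fun k h₁ h₂ s t => by
    rw [coeff_genFun, if_pos (Finset.mem_Icc.mpr ⟨h₁, h₂⟩)]) x

lemma lowerToeplitz_mulVec {R : Matrix ι κ ℂ[T;T⁻¹]} (hR : ∀ s t, OrderGE 0 (R s t))
    (x : Fin (m + 1) × κ → ℂ) :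
    (lowerToeplitz m R).mulVec x = coeffVec (m + 1) (R.mulVec (polyOfCoeffs κ (m + 1) x)) := by
  rw [← toeplitz_mulVec (a := fun k => Matrix.of fun s t => (R s t).coeff k)
    (fun _ _ _ _ _ => rfl)]
  congr 1
  ext y z
  simp only [lowerToeplitz, toeplitz, Matrix.of_apply]
  split_ifs with h
  · rfl
  · rw [hR _ _ _ (by omega)]

lemma upperToeplitz_mulVec {L : Matrix ι κ ℂ[T;T⁻¹]} (hL : ∀ s t, DegLE 0 (L s t))
    (x : Fin (n + 1) × κ → ℂ) :
    (upperToeplitz n L).mulVec x = coeffVec (n + 1) (L.mulVec (polyOfCoeffs κ (n + 1) x)) := by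
  rw [← toeplitz_mulVec (a := fun k => Matrix.of fun s t => (L s t).coeff k)
    (fun _ _ _ _ _ => rfl)]
  congr 1
  ext y z
  simp only [upperToeplitz, toeplitz, Matrix.of_apply]
  split_ifs with h
  · rfl
  · rw [hL _ _ _ (by omega)]

lemma piMatrix_mulVec (x : Fin (n + 1) × Fin N → ℂ) : (piMatrix m n μ).mulVec x =
    coeffVec (m + 1) ((indexDiagInv μ).mulVec (polyOfCoeffs (Fin N) (n + 1) x)) := by
  refine toeplitz_mulVec (fun k _ _ i j => ?_) x
  rw [indexDiagInv, Matrix.diagonal_apply, Matrix.diagonal_apply]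
  split_ifs with h₁ h₂
  · rw [LaurentPolynomial.T_apply, if_pos (by omega)]
  · rw [LaurentPolynomial.T_apply, if_neg (by omega)]
  · rfl

lemma orderGE_sub_polyOfCoeffs {c : ℕ} {f : κ → ℂ[T;T⁻¹]} (hf : ∀ t, OrderGE 0 (f t)) (t : κ) :
    OrderGE c (f t - polyOfCoeffs κ c (coeffVec c f) t) := by
  intro k hk
  rw [coeff_sub']
  by_cases h : 0 ≤ k
  · rw [coeff_polyOfCoeffs_coeffVec f t h hk, sub_self]
  · rw [hf t k (by omega), orderGE_polyOfCoeffs _ t k (by omega), sub_self]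

lemma degLE_sub_polyOfCoeffs {c : ℕ} {f : κ → ℂ[T;T⁻¹]} (hf : ∀ t, DegLE (c - 1) (f t)) (t : κ) :
    DegLE (-1) (f t - polyOfCoeffs κ c (coeffVec c f) t) := by
  intro k hk
  rw [coeff_sub']
  by_cases h : k < c
  · rw [coeff_polyOfCoeffs_coeffVec f t (by omega) h, sub_self]
  · rw [hf t k (by omega), degLE_polyOfCoeffs _ t k (by omega), sub_self]

lemma polyOfCoeffs_coeffVec_eq (c : ℕ) (f : κ → ℂ[T;T⁻¹]) (t : κ) :
    polyOfCoeffs κ c (coeffVec c f) t = truncLT c (f t) - truncLT 0 (f t) := by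
  ext k
  rw [coeff_sub', coeff_truncLT, coeff_truncLT]
  by_cases h₀ : 0 ≤ k
  · by_cases h₁ : k < c
    · rw [coeff_polyOfCoeffs_coeffVec f t h₀ h₁, if_pos h₁, if_neg (by omega), sub_zero]
    · rw [degLE_polyOfCoeffs _ t k (by omega), if_neg h₁, if_neg (by omega), sub_zero]
  · rw [orderGE_polyOfCoeffs _ t k (by omega), if_pos (by omega), if_pos (by omega), sub_self]

/-- A Laurent vector polynomial splits into its terms in `1, …, z ^ (c - 1)`, a polynomial multiple
of `z ^ c`, and negative powers. -/
lemma exists_split (c : ℕ) (f : κ → ℂ[T;T⁻¹]) : ∃ u w : κ → ℂ[T;T⁻¹],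
    (∀ t, OrderGE 0 (u t)) ∧ (∀ t, DegLE (-1) (w t)) ∧
      f = polyOfCoeffs κ c (coeffVec c f) + (LaurentPolynomial.T (c : ℤ) : ℂ[T;T⁻¹]) • u + w := by
  refine ⟨fun t => LaurentPolynomial.T (-(c : ℤ)) * (f t - truncLT c (f t)),
    fun t => truncLT 0 (f t), fun t => ((orderGE_sub_truncLT _ _).T_mul _).mono (by omega),
    fun t => (degLE_truncLT _ _).mono (by omega), ?_⟩
  funext t
  rw [Pi.add_apply, Pi.add_apply, Pi.smul_apply, polyOfCoeffs_coeffVec_eq, smul_eq_mul,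
    ← mul_assoc, ← LaurentPolynomial.T_add, add_neg_cancel, LaurentPolynomial.T_zero]
  ring

/-! ### The generalized inverse of a block Toeplitz matrix -/

/-- A Wiener–Hopf factorization of the symbol gives the generalized inverse `T_R Π T_L` of the
block Toeplitz matrix. -/
theorem ComeFromFactorization.toeplitz_mul {R : Matrix κ (Fin N) ℂ[T;T⁻¹]}
    {L : Matrix (Fin N) ι ℂ[T;T⁻¹]} (h : ComeFromFactorization A m n μ R L) :
    toeplitz m n A * (lowerToeplitz m R * piMatrix m n μ * upperToeplitz n L) * toeplitz m n A =
      toeplitz m n A := by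
  obtain ⟨U, V, W, Y, hU, hV, hVU, hW, hY, hWY, hGW, rfl, rfl⟩ := h
  rw [isPolyInZInv_iff] at hU hV
  rw [isPolyInZ_iff] at hW hY
  have hVG : V * symbol A m n = indexDiag μ * Y := by
    rw [← Matrix.mul_one (symbol A m n), ← hWY, ← Matrix.mul_assoc (symbol A m n), hGW,
      Matrix.mul_assoc, ← Matrix.mul_assoc V, hVU, Matrix.one_mul]
  have hL : ∀ i s, DegLE 0 (V.toCols₂ i s) := fun i s => hV i (Sum.inr s)
  have hR : ∀ t i, OrderGE 0 (W.toRows₁ t i) := fun t i => hW (Sum.inl t) i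
  apply Matrix.mulVec_injective
  funext x
  simp only [← Matrix.mulVec_mulVec]
  set p := polyOfCoeffs κ (m + 1) x with hp
  set y := (toeplitz m n A).mulVec x with hy
  have hy' : y = coeffVec (n + 1) ((genFun A m n).mulVec p) := toeplitz_mulVec_genFun x
  set Q := polyOfCoeffs ι (n + 1) y with hQ
  obtain ⟨u, w, hu, hw, hsplit⟩ := exists_split (n + 1) ((genFun A m n).mulVec p)
  rw [← hy', ← hQ, Nat.cast_add, Nat.cast_one] at hsplit
  -- `f = U₊ (p; -u)` satisfies `L Q = d f` up to negative powers.
  set f := Y.mulVec (Sum.elim p (-u)) with hf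
  have hf₀ : ∀ i, OrderGE 0 (f i) := OrderGE.mulVec (a := 0) (b := 0) hY (by
    rintro (t | s)
    · exact orderGE_polyOfCoeffs x t
    · exact (hu s).neg)
  have hWf : W.toRows₁.mulVec f = p := by
    have : W.mulVec f = Sum.elim p (-u) := by rw [hf, Matrix.mulVec_mulVec, hWY, Matrix.one_mulVec]
    funext t
    exact congrFun this (Sum.inl t)
  -- The rows of `U₋⁻¹ G = d U₊`, applied to `(p; -u)`.
  have hdf : (indexDiag μ).mulVec f = V.toCols₁.mulVec
      ((LaurentPolynomial.T (-(m : ℤ) - 1) : ℂ[T;T⁻¹]) • p) + V.toCols₂.mulVec (Q + w) := by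
    rw [hf, Matrix.mulVec_mulVec, ← hVG, ← Matrix.mulVec_mulVec, symbol, Matrix.fromBlocks_mulVec]
    nth_rw 1 [← Matrix.fromCols_toCols V]
    rw [Matrix.fromCols_mulVec_sumElim]
    simp only [Sum.elim_comp_inl, Sum.elim_comp_inr, Matrix.smul_mulVec, Matrix.one_mulVec,
      Matrix.zero_mulVec, add_zero, hsplit, smul_neg]
    congr 2
    abel
  have hneg₁ : ∀ i, DegLE (-1) ((indexDiag μ).mulVec f i - V.toCols₂.mulVec Q i) := by
    intro i
    rw [hdf, Matrix.mulVec_add, Pi.add_apply, Pi.add_apply,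
      show ∀ a b c : ℂ[T;T⁻¹], a + (b + c) - b = a + c from fun a b c => by ring]
    refine DegLE.add ?_ (by simpa using DegLE.mulVec hL hw i)
    have := DegLE.mulVec (a := 0) (b := -1) (M := V.toCols₁)
      (v := (LaurentPolynomial.T (-(m : ℤ) - 1) : ℂ[T;T⁻¹]) • p) (fun i t => hV i (Sum.inl t))
      (fun t => ((degLE_polyOfCoeffs x t).T_mul _).mono (by push_cast; omega)) i
    simpa using this
  set v := (upperToeplitz n V.toCols₂).mulVec y with hv
  have hv' : v = coeffVec (n + 1) (V.toCols₂.mulVec Q) := upperToeplitz_mulVec hL y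
  set P := polyOfCoeffs (Fin N) (n + 1) v with hP
  have hneg₂ : ∀ i, DegLE (-1) ((indexDiag μ).mulVec f i - P i) := by
    intro i
    have h₁ := degLE_sub_polyOfCoeffs (c := n + 1) (f := V.toCols₂.mulVec Q)
      (fun i => (DegLE.mulVec hL (degLE_polyOfCoeffs y) i).mono (by omega)) i
    rw [← hv'] at h₁
    have := (hneg₁ i).add h₁
    rwa [sub_add_sub_cancel] at this
  have hdiag : ∀ i, (indexDiag μ).mulVec f i = LaurentPolynomial.T (μ i) * f i := fun i => by
    rw [indexDiag, Matrix.mulVec_diagonal]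
  -- For a positive index nothing is lost on truncation, so that `d⁻¹ P` is a polynomial in `z`.
  set D := (indexDiagInv μ).mulVec P with hD
  have hD' : ∀ i, D i = LaurentPolynomial.T (-μ i) * P i := fun i => by
    rw [hD, indexDiagInv, Matrix.mulVec_diagonal]
  have hTT : ∀ (k : ℤ) (g : ℂ[T;T⁻¹]),
      LaurentPolynomial.T k * (LaurentPolynomial.T (-k) * g) = g := fun k g => by
    rw [← mul_assoc, ← LaurentPolynomial.T_add, add_neg_cancel, LaurentPolynomial.T_zero, one_mul]
  have hD₀ : ∀ i, OrderGE 0 (D i) := by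
    intro i
    have hP₀ : OrderGE 0 (P i) := orderGE_polyOfCoeffs v i
    rw [hD']
    by_cases hi : μ i ≤ 0
    · exact (hP₀.T_mul _).mono (by omega)
    · have h₁ : OrderGE 0 ((indexDiag μ).mulVec f i - P i) := by
        rw [hdiag]
        exact ((hf₀ i).T_mul _ |>.mono (by omega)).sub hP₀
      have h₂ : P i = LaurentPolynomial.T (μ i) * f i := by
        rw [← hdiag, eq_comm, ← sub_eq_zero]
        ext k
        by_cases hk : k < 0
        · exact h₁ k hk
        · exact hneg₂ i k (by omega)
      have h₃ := hTT (-μ i) (f i)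
      rw [neg_neg] at h₃
      rw [h₂, h₃]
      exact hf₀ i
  -- The error `g = f - d⁻¹ P` is a polynomial with `d g` in negative powers, so `R g` is in the
  -- kernel of the block Toeplitz matrix.
  set g := f - D with hg
  have hdg : ∀ i, DegLE (-1) ((indexDiag μ).mulVec g i) := by
    intro i
    rw [hg, Matrix.mulVec_sub, Pi.sub_apply, show (indexDiag μ).mulVec D i = P i by
      rw [indexDiag, Matrix.mulVec_diagonal, hD', hTT]]
    exact hneg₂ i
  have hGg : ∀ i, DegLE (-1) ((symbol A m n).mulVec (W.mulVec g) i) := by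
    intro i
    rw [Matrix.mulVec_mulVec, hGW, ← Matrix.mulVec_mulVec]
    simpa using DegLE.mulVec hU hdg i
  have hWg : W.mulVec g = Sum.elim (W.toRows₁.mulVec g) (W.toRows₂.mulVec g) := by
    nth_rw 1 [← Matrix.fromRows_toRows W]
    rw [Matrix.fromRows_mulVec]
  rw [hWg, symbol, Matrix.fromBlocks_mulVec] at hGg
  simp only [Sum.elim_comp_inl, Sum.elim_comp_inr, Matrix.smul_mulVec, Matrix.one_mulVec,
      Matrix.zero_mulVec, add_zero] at hGg
  have hg₀ : ∀ i, OrderGE 0 (g i) := fun i => (hf₀ i).sub (hD₀ i)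
  have hRg₀ : ∀ t, OrderGE 0 (W.toRows₁.mulVec g t) := OrderGE.mulVec (a := 0) (b := 0) hR hg₀
  have hRg₁ : ∀ t, DegLE m (W.toRows₁.mulVec g t) := by
    intro t k hk
    have := hGg (Sum.inl t) (k + (-(m : ℤ) - 1)) (by omega)
    rw [Sum.elim_inl, Pi.smul_apply, smul_eq_mul, coeff_T_mul, add_sub_cancel_right] at this
    exact this
  have hker : (toeplitz m n A).mulVec (coeffVec (m + 1) (W.toRows₁.mulVec g)) = 0 := by
    rw [toeplitz_mulVec_genFun,
      polyOfCoeffs_coeffVec hRg₀ fun t => (hRg₁ t).mono (by push_cast; omega)]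
    funext ⟨i, s⟩
    have h₁ := hGg (Sum.inr s) i (by omega)
    have h₂ : OrderGE 0 (W.toRows₂.mulVec g s) :=
      OrderGE.mulVec (a := 0) (b := 0) (M := W.toRows₂) (fun s i => hW (Sum.inr s) i) hg₀ s
    rw [Sum.elim_inr, Pi.add_apply, Pi.smul_apply, smul_eq_mul, coeff_add', coeff_T_mul,
      h₂ _ (by omega), add_zero] at h₁
    exact h₁
  have hfinal : (lowerToeplitz m W.toRows₁).mulVec ((piMatrix m n μ).mulVec v) =
      x - coeffVec (m + 1) (W.toRows₁.mulVec g) := by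
    rw [lowerToeplitz_mulVec hR, piMatrix_mulVec]
    funext ⟨i, t⟩
    have h₁ : (W.toRows₁.mulVec D t).coeff (i : ℤ) = x (i, t) -
        (W.toRows₁.mulVec g t).coeff (i : ℤ) := by
      rw [← coeff_polyOfCoeffs x t i, ← hp, ← hWf, ← coeff_sub', ← Pi.sub_apply,
        ← Matrix.mulVec_sub, hg, sub_sub_cancel]
    have h₂ : OrderGE (m + 1) (W.toRows₁.mulVec
        (D - polyOfCoeffs (Fin N) (m + 1) (coeffVec (m + 1) D)) t) := by
      have := OrderGE.mulVec (a := 0) hR (orderGE_sub_polyOfCoeffs (c := m + 1) hD₀) t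
      exact this.mono (by push_cast; omega)
    have h₃ := h₂ i (by omega)
    rw [Matrix.mulVec_sub, Pi.sub_apply, coeff_sub', sub_eq_zero, h₁] at h₃
    exact h₃.symm
  rw [hfinal, Matrix.mulVec_sub, hker, sub_zero]

end Factorization

section Duality

/-! ### Duality between the left and the right theory -/

variable {ι κ : Type} [Fintype ι] [Fintype κ] [DecidableEq ι] [DecidableEq κ]
  {A : ℤ → Matrix ι κ ℂ} {m n N : ℕ}

/-- The transpose of a Laurent matrix polynomial, with `z` replaced by `z⁻¹`. -/
def dualMatrix {ι κ : Type} (M : Matrix ι κ ℂ[T;T⁻¹]) : Matrix κ ι ℂ[T;T⁻¹] :=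
  Matrix.of fun j i => LaurentPolynomial.invert (M i j)

lemma dualMatrix_apply {ι κ : Type} (M : Matrix ι κ ℂ[T;T⁻¹]) (i : ι) (j : κ) :
    dualMatrix M j i = LaurentPolynomial.invert (M i j) := rfl

lemma dualMatrix_dualMatrix {ι κ : Type} (M : Matrix ι κ ℂ[T;T⁻¹]) :
    dualMatrix (dualMatrix M) = M := by
  ext1 i j
  exact LaurentPolynomial.involutive_invert _

lemma dualMatrix_injective {ι κ : Type} :
    Function.Injective (dualMatrix : Matrix ι κ ℂ[T;T⁻¹] → _) :=
  Function.LeftInverse.injective dualMatrix_dualMatrix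

lemma dualMatrix_mul {ρ σ τ : Type} [Fintype σ] (M : Matrix ρ σ ℂ[T;T⁻¹])
    (M' : Matrix σ τ ℂ[T;T⁻¹]) : dualMatrix (M * M') = dualMatrix M' * dualMatrix M := by
  ext1 i j
  simp only [dualMatrix_apply, Matrix.mul_apply, map_sum, map_mul, mul_comm]

lemma dualMatrix_sub {ρ σ : Type} (M M' : Matrix ρ σ ℂ[T;T⁻¹]) :
    dualMatrix (M - M') = dualMatrix M - dualMatrix M' := by
  ext1 i j
  simp only [dualMatrix_apply, Matrix.sub_apply, map_sub]

lemma dualMatrix_T_smul {ρ σ : Type} (k : ℤ) (M : Matrix ρ σ ℂ[T;T⁻¹]) :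
    dualMatrix ((LaurentPolynomial.T k : ℂ[T;T⁻¹]) • M) =
      (LaurentPolynomial.T (-k) : ℂ[T;T⁻¹]) • dualMatrix M := by
  ext1 i j
  simp only [dualMatrix_apply, Matrix.smul_apply, smul_eq_mul, map_mul, LaurentPolynomial.invert_T]

lemma dualMatrix_diagonal {σ : Type} [DecidableEq σ] (d : σ → ℂ[T;T⁻¹]) :
    dualMatrix (Matrix.diagonal d) = Matrix.diagonal fun i => LaurentPolynomial.invert (d i) := by
  ext1 i j
  rw [dualMatrix_apply, Matrix.diagonal_apply, Matrix.diagonal_apply]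
  by_cases h : i = j
  · rw [if_pos h, if_pos h.symm, h]
  · rw [if_neg h, if_neg (Ne.symm h), map_zero]

lemma dualMatrix_one {σ : Type} [DecidableEq σ] :
    dualMatrix (1 : Matrix σ σ ℂ[T;T⁻¹]) = 1 := by
  rw [← Matrix.diagonal_one, dualMatrix_diagonal]
  simp

lemma dualMatrix_indexDiag (μ : Fin N → ℤ) : dualMatrix (indexDiag μ) = indexDiag (-μ) := by
  rw [indexDiag, dualMatrix_diagonal, indexDiag]
  simp

lemma dualMatrix_indexDiagInv (μ : Fin N → ℤ) :
    dualMatrix (indexDiagInv μ) = indexDiagInv (-μ) := by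
  rw [indexDiagInv, dualMatrix_diagonal, indexDiagInv]
  simp

lemma isPolyInZ_dualMatrix {ι κ : Type} {M : Matrix ι κ ℂ[T;T⁻¹]} :
    IsPolyInZ (dualMatrix M) ↔ IsPolyInZInv M := by
  rw [isPolyInZ_iff, isPolyInZInv_iff, forall_comm]
  simp only [dualMatrix_apply, orderGE_invert, neg_zero]

lemma isPolyInZInv_dualMatrix {ι κ : Type} {M : Matrix ι κ ℂ[T;T⁻¹]} :
    IsPolyInZInv (dualMatrix M) ↔ IsPolyInZ M := by
  rw [← isPolyInZ_dualMatrix, dualMatrix_dualMatrix]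

lemma dualMatrix_genFun : dualMatrix (genFun A m n) = genFun (dualSeq A) n m := by
  ext1 t s
  ext k
  rw [dualMatrix_apply, LaurentPolynomial.invert_apply, coeff_genFun, coeff_genFun]
  refine if_congr ?_ rfl rfl
  simp only [Finset.mem_Icc]
  omega

/-- The substitution `z ↦ z⁻¹` in a Laurent vector polynomial. -/
def dualVec (ι : Type) : (ι → ℂ[T;T⁻¹]) ≃ₗ[ℂ] (ι → ℂ[T;T⁻¹]) :=
  LinearEquiv.piCongrRight fun _ => (LaurentPolynomial.invert (R := ℂ)).toLinearEquiv

lemma dualVec_apply (l : ι → ℂ[T;T⁻¹]) (s : ι) :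
    dualVec ι l s = LaurentPolynomial.invert (l s) := rfl

lemma dualVec_dualVec (l : ι → ℂ[T;T⁻¹]) : dualVec ι (dualVec ι l) = l :=
  funext fun _ => LaurentPolynomial.involutive_invert _

lemma dualVec_mem_rightSpace {k : ℤ} {l : ι → ℂ[T;T⁻¹]} :
    dualVec ι l ∈ rightSpace (dualSeq A) n m (-k) ↔ l ∈ leftSpace A m n k := by
  have h : ∀ t, (genFun (dualSeq A) n m).mulVec (dualVec ι l) t =
      LaurentPolynomial.invert (Matrix.vecMul l (genFun A m n) t) := by
    intro t
    simp only [← dualMatrix_genFun, Matrix.mulVec, Matrix.vecMul, dotProduct, map_sum, map_mul,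
      dualMatrix_apply, dualVec_apply, mul_comm]
  rw [mem_rightSpace, mem_leftSpace]
  simp only [h, dualVec_apply, orderGE_invert, degLE_invert, LaurentPolynomial.invert_apply,
    neg_zero, neg_add_rev, neg_neg]
  rw [and_comm (a := ∀ t, DegLE 0 (l t)), show -(n : ℤ) + k = k - n by ring]
  refine and_congr_right fun _ => ⟨fun H i h₁ h₂ t => ?_, fun H i h₁ h₂ t =>
    H (-i) (by omega) (by omega) t⟩
  have := H (-i) (by omega) (by omega) t
  rwa [neg_neg] at this

lemma map_dualVec_leftSpace (k : ℤ) : (leftSpace A m n k).map (dualVec ι).toLinearMap =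
    rightSpace (dualSeq A) n m (-k) := by
  ext r
  constructor
  · rintro ⟨l, hl, rfl⟩
    exact dualVec_mem_rightSpace.mpr hl
  · intro hr
    refine ⟨dualVec ι r, ?_, dualVec_dualVec r⟩
    rw [SetLike.mem_coe, ← dualVec_mem_rightSpace, dualVec_dualVec]
    exact hr

lemma map_dualVec_map_shift (S : Submodule ℂ (ι → ℂ[T;T⁻¹])) (s : ℤ) :
    (S.map (shift ι (-s))).map (dualVec ι).toLinearMap =
      (S.map (dualVec ι).toLinearMap).map (shift ι s) := by
  rw [← Submodule.map_comp, ← Submodule.map_comp]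
  congr 1
  refine LinearMap.ext fun l => funext fun t => ?_
  simp [shift_apply, dualVec_apply]

lemma IsComplementBasis.map {V V' τ τ' : Type} [AddCommGroup V] [Module ℂ V] [AddCommGroup V']
    [Module ℂ V'] {v : τ → V} {S W : Submodule ℂ V} (h : IsComplementBasis v S W)
    (f : V ≃ₗ[ℂ] V') (e : τ' ≃ τ) :
    IsComplementBasis (fun t => f (v (e t))) (S.map f.toLinearMap) (W.map f.toLinearMap) := by
  have hspan : Submodule.span ℂ (Set.range fun t => f (v (e t))) =
      (Submodule.span ℂ (Set.range v)).map f.toLinearMap := by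
    rw [Submodule.map_span, ← Set.range_comp, ← e.surjective.range_comp]
    rfl
  refine ⟨?_, ?_, ?_⟩
  · exact (h.linearIndependent.comp e e.injective).map' f.toLinearMap f.ker
  · rw [hspan]
    exact Submodule.disjoint_map f.injective h.disjoint
  · rw [hspan, ← Submodule.map_sup, h.sup_eq]

lemma isComplementBasis_dual_iff {μ : Fin N → ℤ} {L : Matrix (Fin N) ι ℂ[T;T⁻¹]} (k : ℤ) :
    IsComplementBasis (fun (j : {j : Fin N // (-μ) j = -k}) (t : ι) => dualMatrix L t j)
        (rightSpace (dualSeq A) n m (-k) ⊔ (rightSpace (dualSeq A) n m (-k)).map (shift ι 1))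
        (rightSpace (dualSeq A) n m (-k + 1)) ↔
      IsComplementBasis (fun (j : {j : Fin N // μ j = k}) (t : ι) => L j t)
        (leftSpace A m n k ⊔ (leftSpace A m n k).map (shift ι (-1))) (leftSpace A m n (k - 1)) := by
  let e : {j : Fin N // (-μ) j = -k} ≃ {j : Fin N // μ j = k} :=
    Equiv.subtypeEquivRight fun j => by simp
  have hS : rightSpace (dualSeq A) n m (-k) ⊔
      (rightSpace (dualSeq A) n m (-k)).map (shift ι 1) =
      (leftSpace A m n k ⊔ (leftSpace A m n k).map (shift ι (-1))).map
        (dualVec ι).toLinearMap := by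
    rw [Submodule.map_sup, map_dualVec_map_shift, map_dualVec_leftSpace]
  have hW : rightSpace (dualSeq A) n m (-k + 1) =
      (leftSpace A m n (k - 1)).map (dualVec ι).toLinearMap := by
    rw [map_dualVec_leftSpace, neg_sub, neg_add_eq_sub]
  have hback : ∀ S : Submodule ℂ (ι → ℂ[T;T⁻¹]),
      (S.map (dualVec ι).toLinearMap).map (dualVec ι).toLinearMap = S := by
    intro S
    rw [← Submodule.map_comp]
    convert Submodule.map_id S
    exact LinearMap.ext dualVec_dualVec
  rw [hS, hW]
  constructor
  · intro h
    have := h.map (dualVec ι) e.symm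
    rw [hback, hback] at this
    convert this using 2 with j
    funext t
    exact (LaurentPolynomial.involutive_invert _).symm
  · intro h
    exact h.map (dualVec ι) e

/-- A full left system is the dual of a full right system of the dual sequence, whose indices are
the negatives of the given ones. -/
lemma isFullLeftSystem_iff {L : Matrix (Fin N) ι ℂ[T;T⁻¹]} {α : Matrix (Fin N) κ ℂ[T;T⁻¹]} :
    IsFullLeftSystem A m n L α ↔ IsRightSystem (dualSeq A) n m (-indices A m n N) (dualMatrix L)
      (dualMatrix α) := by
  set μ := indices A m n N with hμ
  have hess : IsLeftEssential A m n L ↔ ∀ k ∈ Finset.Icc (-(n : ℤ) - 1) m,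
      IsComplementBasis (fun (j : {j : Fin N // (-μ) j = k}) (t : ι) => dualMatrix L t j)
        (rightSpace (dualSeq A) n m k ⊔ (rightSpace (dualSeq A) n m k).map (shift ι 1))
        (rightSpace (dualSeq A) n m (k + 1)) := by
    constructor
    · intro h k hk
      rw [Finset.mem_Icc] at hk
      have := (isComplementBasis_dual_iff _).mpr (h (-k) (Finset.mem_Icc.mpr (by omega)))
      rwa [neg_neg] at this
    · intro h k hk
      rw [Finset.mem_Icc] at hk
      exact (isComplementBasis_dual_iff _).mp (h (-k) (Finset.mem_Icc.mpr (by omega)))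
  have hdec : ∀ β : Matrix (Fin N) κ ℂ[T;T⁻¹],
      L * genFun A m n = indexDiag μ * α - (LaurentPolynomial.T (-(m : ℤ) - 1) : ℂ[T;T⁻¹]) • β ↔
      genFun (dualSeq A) n m * dualMatrix L = dualMatrix α * indexDiag (-μ) -
        (LaurentPolynomial.T ((m : ℤ) + 1) : ℂ[T;T⁻¹]) • dualMatrix β := by
    intro β
    rw [← dualMatrix_injective.eq_iff, dualMatrix_mul, dualMatrix_genFun, dualMatrix_sub,
      dualMatrix_mul, dualMatrix_indexDiag, dualMatrix_T_smul,
      show -(-(m : ℤ) - 1) = m + 1 by ring]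
  have hdeg : (∀ j, μ j = -(m : ℤ) - 1 → ∀ t, SupportedIn (L j t) (-(n + m + 2)) 0) ↔
      ∀ j, (-μ) j = m + 1 → ∀ t, SupportedIn (dualMatrix L t j) 0 (m + n + 2) := by
    refine forall_congr' fun j => imp_congr ?_ (forall_congr' fun t => ?_)
    · rw [Pi.neg_apply]
      omega
    · rw [supportedIn_iff, supportedIn_iff, dualMatrix_apply, orderGE_invert, degLE_invert,
        and_comm, neg_zero, add_comm (m : ℤ)]
  have hset : ({v : κ → ℂ | ∃ k ∈ Finset.Icc (-(m : ℤ)) n, ∃ s, v = fun t => A k s t} ∪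
      {v : κ → ℂ | ∃ j, μ j = -(m : ℤ) - 1 ∧ v = fun t => (α j t).coeff 0}) =
      {v : κ → ℂ | ∃ k ∈ Finset.Icc (-(n : ℤ)) m, ∃ t, v = fun s => dualSeq A k s t} ∪
      {v : κ → ℂ | ∃ j, (-μ) j = m + 1 ∧ v = fun s => (dualMatrix α s j).coeff 0} := by
    congr 1
    · ext v
      constructor
      · rintro ⟨k, hk, s, rfl⟩
        rw [Finset.mem_Icc] at hk
        refine ⟨-k, Finset.mem_Icc.mpr (by omega), s, ?_⟩
        rw [dualSeq, neg_neg]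
        rfl
      · rintro ⟨k, hk, s, rfl⟩
        rw [Finset.mem_Icc] at hk
        exact ⟨-k, Finset.mem_Icc.mpr (by omega), s, rfl⟩
    · ext v
      refine exists_congr fun j => and_congr ?_ ?_
      · rw [Pi.neg_apply]
        omega
      · simp only [dualMatrix_apply, LaurentPolynomial.invert_apply, neg_zero]
  constructor
  · rintro ⟨h₁, h₂, ⟨β, hβ, h₃⟩, h₄, h₅⟩
    exact ⟨hess.mp h₁, isPolyInZInv_dualMatrix.mpr h₂,
      ⟨dualMatrix β, isPolyInZ_dualMatrix.mpr hβ, (hdec β).mp h₃⟩, hdeg.mp h₄, hset ▸ h₅⟩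
  · rintro ⟨h₁, h₂, ⟨β, hβ, h₃⟩, h₄, h₅⟩
    refine ⟨hess.mpr h₁, isPolyInZInv_dualMatrix.mp h₂,
      ⟨dualMatrix β, isPolyInZInv_dualMatrix.mpr hβ, (hdec _).mpr ?_⟩, hdeg.mpr h₄, hset ▸ h₅⟩
    rwa [dualMatrix_dualMatrix]

/-- The matrix `U₊` is the dual of the matrix `U₋` of the dual sequence, with its blocks
interchanged. -/
lemma rightFactor_dualMatrix (L : Matrix (Fin N) ι ℂ[T;T⁻¹]) (α : Matrix (Fin N) κ ℂ[T;T⁻¹]) :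
    rightFactor n (-indices A m n N) (dualMatrix L) (dualMatrix α) =
      (dualMatrix (uPlus A m n L α)).submatrix Sum.swap id := by
  have h : ∀ M : Matrix (Fin N) ι ℂ[T;T⁻¹],
      (dualMatrix (Matrix.fromCols α M)).submatrix Sum.swap id =
        Matrix.fromRows (dualMatrix M) (dualMatrix α) := by
    intro M
    ext1 (s | t) j <;> rfl
  rw [uPlus, h, rightFactor, dualMatrix_T_smul, dualMatrix_mul, dualMatrix_indexDiagInv,
    neg_add']

section Conforming

variable {L : Matrix (Fin N) ι ℂ[T;T⁻¹]} {α : Matrix (Fin N) κ ℂ[T;T⁻¹]}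

theorem IsFullRightSystem.exists_isConformingLeft {R : Matrix κ (Fin N) ℂ[T;T⁻¹]}
    {α : Matrix ι (Fin N) ℂ[T;T⁻¹]} (h : IsFullRightSystem A m n R α)
    (hN : N = Fintype.card ι + Fintype.card κ) : ∃ L, IsConformingLeft A m n R α L := by
  rw [isFullRightSystem_iff] at h
  have hμ := isIndexFamily_indices (A := A) (m := m) (n := n) hN
  obtain ⟨⟨V, hV, h₁, h₂⟩, -⟩ := h.exists_inverses hμ hN
  exact ⟨_, h.isPolyInZInv_rightFactor hμ, V, hV, h₁, h₂, rfl⟩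

theorem IsFullLeftSystem.exists_isConformingRight (h : IsFullLeftSystem A m n L α)
    (hN : N = Fintype.card ι + Fintype.card κ) : ∃ R, IsConformingRight A m n L α R := by
  rw [isFullLeftSystem_iff] at h
  have hμ := (isIndexFamily_indices (A := A) (m := m) (n := n) hN).dual hN
  have hN' : N = Fintype.card κ + Fintype.card ι := by rw [hN, add_comm]
  obtain ⟨⟨V, hV, h₁, h₂⟩, -⟩ := h.exists_inverses hμ hN'
  have hU := h.isPolyInZInv_rightFactor hμ
  rw [rightFactor_dualMatrix] at h₁ h₂ hU
  refine ⟨_, ?_, dualMatrix (V.submatrix id Sum.swap), ?_, ?_, ?_, rfl⟩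
  · rw [← isPolyInZInv_dualMatrix]
    intro x j k hk
    exact hU (Sum.swap x) j k (by simpa using hk)
  · rw [isPolyInZ_dualMatrix]
    exact fun i x k hk => hV i (Sum.swap x) k hk
  · apply dualMatrix_injective
    rw [dualMatrix_mul, dualMatrix_dualMatrix, dualMatrix_one, ← h₂]
    have := Matrix.submatrix_mul_equiv V
      ((dualMatrix (uPlus A m n L α)).submatrix Sum.swap id) id (Equiv.sumComm κ ι) id
    rw [Matrix.submatrix_id_id] at this
    rw [← this]
    congr 1
    ext1 x j
    simp
  · apply dualMatrix_injective
    rw [dualMatrix_mul, dualMatrix_dualMatrix, dualMatrix_one]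
    have := congrArg (fun M => M.submatrix (Equiv.sumComm κ ι) (Equiv.sumComm κ ι)) h₁
    simp only [Matrix.submatrix_one_equiv] at this
    rw [← this]
    ext1 x y
    simp [Matrix.mul_apply]

lemma IsConformingRight.comeFromFactorization {R : Matrix κ (Fin N) ℂ[T;T⁻¹]}
    (h : IsFullLeftSystem A m n L α) (hN : N = Fintype.card ι + Fintype.card κ)
    (hR : IsConformingRight A m n L α R) :
    ComeFromFactorization (dualSeq A) n m (-indices A m n N) (dualMatrix L) (dualMatrix R) := by
  rw [isFullLeftSystem_iff] at h
  have hμ := (isIndexFamily_indices (A := A) (m := m) (n := n) hN).dual hN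
  have hN' : N = Fintype.card κ + Fintype.card ι := by rw [hN, add_comm]
  obtain ⟨-, V, hV, h₁, -, rfl⟩ := hR
  refine h.comeFromFactorization hμ hN' (V := (dualMatrix V).submatrix id Sum.swap) ?_ ?_
  · exact fun i x k hk => isPolyInZInv_dualMatrix.mpr hV i (Sum.swap x) k hk
  · rw [rightFactor_dualMatrix]
    have := Matrix.submatrix_mul_equiv (dualMatrix V) (dualMatrix (uPlus A m n L α)) id
      (Equiv.sumComm ι κ) id
    refine this.trans ?_
    rw [Matrix.submatrix_id_id, ← dualMatrix_mul, h₁, dualMatrix_one]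

lemma toeplitz_dualSeq : toeplitz n m (dualSeq A) = (toeplitz m n A).transpose := by
  ext x y
  simp only [toeplitz, dualSeq, Matrix.of_apply, Matrix.transpose_apply, neg_sub]

lemma lowerToeplitz_dualMatrix (L : Matrix (Fin N) ι ℂ[T;T⁻¹]) :
    lowerToeplitz n (dualMatrix L) = (upperToeplitz n L).transpose := by
  ext x y
  simp only [lowerToeplitz, upperToeplitz, Matrix.of_apply, Matrix.transpose_apply,
    dualMatrix_apply, LaurentPolynomial.invert_apply, neg_sub]

lemma upperToeplitz_dualMatrix (R : Matrix κ (Fin N) ℂ[T;T⁻¹]) :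
    upperToeplitz m (dualMatrix R) = (lowerToeplitz m R).transpose := by
  ext x y
  simp only [lowerToeplitz, upperToeplitz, Matrix.of_apply, Matrix.transpose_apply,
    dualMatrix_apply, LaurentPolynomial.invert_apply, neg_sub]

lemma piMatrix_neg (μ : Fin N → ℤ) : piMatrix n m (-μ) = (piMatrix m n μ).transpose := by
  ext x y
  simp only [piMatrix, toeplitz, Matrix.of_apply, Matrix.transpose_apply, Matrix.diagonal_apply]
  by_cases h : x.2 = y.2
  · rw [if_pos h, if_pos h.symm, h]
    refine if_congr ?_ rfl rfl
    rw [Pi.neg_apply]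
    omega
  · rw [if_neg h, if_neg (Ne.symm h)]

/-- A conforming pair gives a generalized inverse of the block Toeplitz matrix of the sequence. -/
theorem AreConforming.toeplitz_mul {R : Matrix κ (Fin N) ℂ[T;T⁻¹]}
    (h : AreConforming A m n R L) (hN : N = Fintype.card ι + Fintype.card κ) :
    toeplitz m n A *
        (lowerToeplitz m R * piMatrix m n (indices A m n N) * upperToeplitz n L) *
      toeplitz m n A = toeplitz m n A := by
  rcases h with ⟨α, h, -, V, hV, -, hVU, rfl⟩ | ⟨α, h, hR⟩
  · exact ((isFullRightSystem_iff.mp h).comeFromFactorization (isIndexFamily_indices hN) hN hV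
      hVU).toeplitz_mul
  · have := (hR.comeFromFactorization h hN).toeplitz_mul
    rw [toeplitz_dualSeq, lowerToeplitz_dualMatrix, upperToeplitz_dualMatrix, piMatrix_neg] at this
    apply Matrix.transpose_injective
    simp only [Matrix.transpose_mul, Matrix.mul_assoc] at this ⊢
    exact this

end Conforming

end Duality

section ToeplitzPlusHankel

/-! ### Toeplitz-plus-Hankel matrices -/

variable {ρ τ : Type} [Fintype ρ] [Fintype τ] [DecidableEq ρ] [DecidableEq τ]

lemma blockFlip_eq (k : ℕ) : blockFlip k ρ =
    (1 : Matrix (Fin (k + 1) × ρ) (Fin (k + 1) × ρ) ℂ).submatrix (Prod.map Fin.rev id)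
      (Equiv.refl _) := by
  ext x y
  simp only [blockFlip, Matrix.of_apply, Matrix.submatrix_apply, Equiv.refl_apply,
    Matrix.one_apply]
  refine if_congr ?_ rfl rfl
  rw [Prod.ext_iff, Fin.ext_iff, Prod.map_fst, Prod.map_snd, Fin.val_rev, id]
  refine and_congr_left fun _ => ?_
  omega

lemma blockFlip_mul (k : ℕ) {σ : Type} (M : Matrix (Fin (k + 1) × ρ) σ ℂ) :
    blockFlip k ρ * M = M.submatrix (Prod.map Fin.rev id) id := by
  rw [blockFlip_eq, Matrix.one_submatrix_mul]
  rfl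

lemma blockFlip_transpose (k : ℕ) : (blockFlip k ρ).transpose = blockFlip k ρ := by
  ext x y
  simp only [blockFlip, Matrix.of_apply, Matrix.transpose_apply]
  refine if_congr ?_ rfl rfl
  rw [add_comm, eq_comm (a := x.2)]

lemma mul_blockFlip (k : ℕ) {σ : Type} (M : Matrix σ (Fin (k + 1) × ρ) ℂ) :
    M * blockFlip k ρ = M.submatrix id (Prod.map Fin.rev id) := by
  rw [← Matrix.transpose_transpose (M * _), Matrix.transpose_mul, blockFlip_transpose,
    blockFlip_mul]
  rfl

lemma blockFlip_mul_blockFlip (k : ℕ) : blockFlip k ρ * blockFlip k ρ = 1 := by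
  rw [blockFlip_mul, blockFlip_eq, Matrix.submatrix_submatrix]
  rw [Prod.map_comp_map, Fin.rev_involutive.comp_self, Function.comp_id, Prod.map_id]
  exact Matrix.submatrix_id_id _

/-- The symmetrization argument: the block matrix `K` is `diag(J, 1) (H T; T H) diag(1, J)`, which
intertwines `(1; s J)` and `(s J; 1)` with `T + s H` when `s² = 1`, so a generalized inverse of `K`
compresses to one of `T + s H`. -/
lemma mul_compression_mul {x y σ σ' : Type} [Fintype x] [Fintype y] [Fintype σ] [Fintype σ']
    [DecidableEq x] [DecidableEq y] {T H : Matrix x y ℂ} {J : Matrix x x ℂ} {J' : Matrix y y ℂ}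
    (hJ : J * J = 1) (hJ' : J' * J' = 1) {R₁ R₂ : Matrix y σ ℂ} {P : Matrix σ σ' ℂ}
    {L₁ L₂ : Matrix σ' x ℂ}
    (hK : Matrix.fromBlocks (J * H) (J * T * J') T (H * J') *
        (Matrix.fromRows R₁ R₂ * P * Matrix.fromCols L₁ L₂) *
        Matrix.fromBlocks (J * H) (J * T * J') T (H * J') =
      Matrix.fromBlocks (J * H) (J * T * J') T (H * J')) {s : ℂ} (hs : s * s = 1) :
    (T + s • H) * ((1 / 2 : ℂ) • ((R₁ + s • (J' * R₂)) * P * (L₂ + s • (L₁ * J)))) *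
      (T + s • H) = T + s • H := by
  set K := Matrix.fromBlocks (J * H) (J * T * J') T (H * J') with hKdef
  set M := T + s • H with hM
  set E := Matrix.fromRows (1 : Matrix y y ℂ) (s • J') with hE
  set F := Matrix.fromRows (s • J) (1 : Matrix x x ℂ) with hF
  set E' := Matrix.fromCols (1 : Matrix y y ℂ) (s • J') with hE'
  set F' := Matrix.fromCols (s • J) (1 : Matrix x x ℂ) with hF'
  have h₁ : K * E = F * M := by
    rw [hKdef, hE, hF, hM, Matrix.fromBlocks_mul_fromRows, Matrix.fromRows_mul]
    congr 1
    · simp only [Matrix.mul_one, Matrix.mul_smul, Matrix.smul_mul, Matrix.mul_add, smul_smul, hs,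
        one_smul, Matrix.mul_assoc, hJ']
      rw [add_comm]
    · simp only [Matrix.mul_one, Matrix.mul_smul, Matrix.mul_assoc, hJ', Matrix.one_mul]
  have h₂ : F' * K = M * E' := by
    rw [hKdef, hE', hF', hM, Matrix.fromCols_mul_fromBlocks, Matrix.mul_fromCols]
    congr 1
    · simp only [Matrix.mul_one, Matrix.smul_mul, ← Matrix.mul_assoc, hJ, Matrix.one_mul]
      rw [add_comm]
    · simp only [Matrix.smul_mul, Matrix.mul_smul, ← Matrix.mul_assoc, hJ, Matrix.one_mul,
        Matrix.add_mul, smul_add, smul_smul, hs, one_smul]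
  have h₃ : F' * F = (2 : ℂ) • 1 := by
    rw [hF, hF', Matrix.fromCols_mul_fromRows, Matrix.smul_mul, Matrix.mul_smul, smul_smul, hJ, hs,
      Matrix.mul_one, one_smul, two_smul]
  have h₄ : R₁ + s • (J' * R₂) = E' * Matrix.fromRows R₁ R₂ := by
    rw [hE', Matrix.fromCols_mul_fromRows, Matrix.one_mul, Matrix.smul_mul]
  have h₅ : L₂ + s • (L₁ * J) = Matrix.fromCols L₁ L₂ * F := by
    rw [hF, Matrix.fromCols_mul_fromRows, Matrix.mul_one, Matrix.mul_smul, add_comm]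
  rw [h₄, h₅, Matrix.mul_smul, Matrix.smul_mul]
  have h₆ : M * (E' * Matrix.fromRows R₁ R₂ * P * (Matrix.fromCols L₁ L₂ * F)) * M =
      F' * (K * (Matrix.fromRows R₁ R₂ * P * Matrix.fromCols L₁ L₂) * K) * E := by
    calc _ = (M * E') * (Matrix.fromRows R₁ R₂ * P * Matrix.fromCols L₁ L₂) * (F * M) := by
          simp only [Matrix.mul_assoc]
      _ = _ := by
          rw [← h₁, ← h₂]
          simp only [Matrix.mul_assoc]
  rw [h₆, hK, Matrix.mul_assoc, h₁, ← Matrix.mul_assoc, h₃, Matrix.smul_mul, Matrix.one_mul,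
    smul_smul]
  norm_num

/-- Up to the order of the rows and columns, the block Toeplitz matrix of the auxiliary sequence is
`diag(J, 1) (H T; T H) diag(1, J)`. -/
lemma toeplitz_auxSeq_submatrix {p q : ℕ} (m n : ℕ) (a b : ℤ → Matrix (Fin p) (Fin q) ℂ) :
    (toeplitz m n (auxSeq m n a b)).submatrix (Equiv.prodSumDistrib _ _ _).symm
        (Equiv.prodSumDistrib _ _ _).symm =
      Matrix.fromBlocks (blockFlip n (Fin p) * hankel m n b)
        (blockFlip n (Fin p) * toeplitz m n a * blockFlip m (Fin q)) (toeplitz m n a)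
        (hankel m n b * blockFlip m (Fin q)) := by
  rw [blockFlip_mul, blockFlip_mul, mul_blockFlip, mul_blockFlip]
  ext (⟨i, s⟩ | ⟨i, s⟩) (⟨j, t⟩ | ⟨j, t⟩) <;>
    simp only [toeplitz, hankel, auxSeq, Matrix.submatrix_apply, Matrix.of_apply,
      Equiv.prodSumDistrib_symm_apply_left, Equiv.prodSumDistrib_symm_apply_right,
      Matrix.fromBlocks_apply₁₁, Matrix.fromBlocks_apply₁₂, Matrix.fromBlocks_apply₂₁,
      Matrix.fromBlocks_apply₂₂, Prod.map_fst, Prod.map_snd, id, Fin.val_rev] <;>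
    congr 1 <;> omega

theorem mul_inversionFormula_mul {p q N : ℕ} {m n : ℕ} {a b : ℤ → Matrix (Fin p) (Fin q) ℂ}
    (hN : N = 2 * (p + q)) {R : Matrix (Fin q ⊕ Fin q) (Fin N) ℂ[T;T⁻¹]}
    {L : Matrix (Fin N) (Fin p ⊕ Fin p) ℂ[T;T⁻¹]} (h : AreConforming (auxSeq m n a b) m n R L)
    {s : ℂ} (hs : s * s = 1) :
    (toeplitz m n a + s • hankel m n b) *
        inversionFormula m n (indices (auxSeq m n a b) m n N) R L s *
      (toeplitz m n a + s • hankel m n b) = toeplitz m n a + s • hankel m n b := by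
  have h₀ := h.toeplitz_mul (by simp only [Fintype.card_sum, Fintype.card_fin]; omega)
  refine mul_compression_mul (blockFlip_mul_blockFlip n) (blockFlip_mul_blockFlip m) ?_ hs
  rw [← toeplitz_auxSeq_submatrix]
  have hR : Matrix.fromRows (lowerToeplitz m R.toRows₁) (lowerToeplitz m R.toRows₂) =
      (lowerToeplitz m R).submatrix (Equiv.prodSumDistrib _ _ _).symm (Equiv.refl _) := by
    ext (x | x) y <;> rfl
  have hL : Matrix.fromCols (upperToeplitz n L.toCols₁) (upperToeplitz n L.toCols₂) =
      (upperToeplitz n L).submatrix (Equiv.refl _) (Equiv.prodSumDistrib _ _ _).symm := by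
    ext x (y | y) <;> rfl
  have hP : piMatrix m n (indices (auxSeq m n a b) m n N) =
      (piMatrix m n (indices (auxSeq m n a b) m n N)).submatrix (Equiv.refl _)
        (Equiv.refl _) := rfl
  rw [hR, hL, hP, Matrix.submatrix_mul_equiv, Matrix.submatrix_mul_equiv,
    Matrix.submatrix_mul_equiv, Matrix.submatrix_mul_equiv, h₀]

end ToeplitzPlusHankel

end

end ToeplitzHankel

open ToeplitzHankel in
theorem mainTheorem1 (m n p q : ℕ) (a b : ℤ → Matrix (Fin p) (Fin q) ℂ) :
    -- full sets of right and of left essential polynomials exist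
    (∃ (R : Matrix (Fin q ⊕ Fin q) (Fin (2 * (p + q))) ℂ[T;T⁻¹])
      (α : Matrix (Fin p ⊕ Fin p) (Fin (2 * (p + q))) ℂ[T;T⁻¹]),
      IsFullRightSystem (auxSeq m n a b) m n R α) ∧
    (∃ (L : Matrix (Fin (2 * (p + q))) (Fin p ⊕ Fin p) ℂ[T;T⁻¹])
      (α : Matrix (Fin (2 * (p + q))) (Fin q ⊕ Fin q) ℂ[T;T⁻¹]),
      IsFullLeftSystem (auxSeq m n a b) m n L α) ∧
    -- each of them can be completed to a conforming pair
    (∀ (R : Matrix (Fin q ⊕ Fin q) (Fin (2 * (p + q))) ℂ[T;T⁻¹])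
      (α : Matrix (Fin p ⊕ Fin p) (Fin (2 * (p + q))) ℂ[T;T⁻¹]),
      IsFullRightSystem (auxSeq m n a b) m n R α →
        ∃ L, IsConformingLeft (auxSeq m n a b) m n R α L) ∧
    (∀ (L : Matrix (Fin (2 * (p + q))) (Fin p ⊕ Fin p) ℂ[T;T⁻¹])
      (α : Matrix (Fin (2 * (p + q))) (Fin q ⊕ Fin q) ℂ[T;T⁻¹]),
      IsFullLeftSystem (auxSeq m n a b) m n L α →
        ∃ R, IsConformingRight (auxSeq m n a b) m n L α R) ∧
    -- the inversion formulas for `T + H` (`s = 1`) and `T - H` (`s = -1`)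
    (∀ (R : Matrix (Fin q ⊕ Fin q) (Fin (2 * (p + q))) ℂ[T;T⁻¹])
      (L : Matrix (Fin (2 * (p + q))) (Fin p ⊕ Fin p) ℂ[T;T⁻¹]),
      AreConforming (auxSeq m n a b) m n R L →
      ∀ s : ℂ, s = 1 ∨ s = -1 →
      ∀ (M : Matrix (Fin (n + 1) × Fin p) (Fin (m + 1) × Fin q) ℂ)
        (X : Matrix (Fin (m + 1) × Fin q) (Fin (n + 1) × Fin p) ℂ),
        M = toeplitz m n a + s • hankel m n b →
        X = inversionFormula m n (indices (auxSeq m n a b) m n (2 * (p + q))) R L s →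
        M * X * M = M ∧
        ((∃ Y : Matrix (Fin (m + 1) × Fin q) (Fin (n + 1) × Fin p) ℂ,
          M * Y = 1 ∧ Y * M = 1) → M * X = 1 ∧ X * M = 1) ∧
        ((∃ Y : Matrix (Fin (m + 1) × Fin q) (Fin (n + 1) × Fin p) ℂ, Y * M = 1) → X * M = 1) ∧
        ((∃ Y : Matrix (Fin (m + 1) × Fin q) (Fin (n + 1) × Fin p) ℂ, M * Y = 1) → M * X = 1)) := by
  have hN : 2 * (p + q) = Fintype.card (Fin p ⊕ Fin p) + Fintype.card (Fin q ⊕ Fin q) := by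
    simp only [Fintype.card_sum, Fintype.card_fin]
    omega
  have hμ := isIndexFamily_indices (A := auxSeq m n a b) (m := m) (n := n) hN
  refine ⟨?_, ?_, fun R α h => h.exists_isConformingLeft hN,
    fun L α h => h.exists_isConformingRight hN, ?_⟩
  · obtain ⟨R, α, h⟩ := exists_isRightSystem hμ hN
    exact ⟨R, α, isFullRightSystem_iff.mpr h⟩
  · obtain ⟨L, α, h⟩ := exists_isRightSystem (hμ.dual hN) (hN.trans (add_comm _ _))
    refine ⟨dualMatrix L, dualMatrix α, isFullLeftSystem_iff.mpr ?_⟩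
    rwa [dualMatrix_dualMatrix, dualMatrix_dualMatrix]
  · intro R L h s hs M X hM hX
    have hMXM : M * X * M = M := by
      rw [hM, hX]
      exact mul_inversionFormula_mul rfl h (by rcases hs with rfl | rfl <;> norm_num)
    have hleft : ∀ Y : Matrix (Fin (m + 1) × Fin q) (Fin (n + 1) × Fin p) ℂ,
        Y * M = 1 → X * M = 1 := fun Y hY => by
      rw [← Matrix.one_mul (X * M), ← hY, Matrix.mul_assoc, ← Matrix.mul_assoc M, hMXM]
    have hright : ∀ Y : Matrix (Fin (m + 1) × Fin q) (Fin (n + 1) × Fin p) ℂ,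
        M * Y = 1 → M * X = 1 := fun Y hY => by
      rw [← Matrix.mul_one (M * X), ← hY, ← Matrix.mul_assoc, hMXM]
    exact ⟨hMXM, fun ⟨Y, h₁, h₂⟩ => ⟨hright Y h₁, hleft Y h₂⟩, fun ⟨Y, hY⟩ => hleft Y hY,
      fun ⟨Y, hY⟩ => hright Y hY⟩
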